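/- Let $N\cong\mathbb{Z}^n$ be a lattice with $n\ge 1$, let $M=\operatorname{Hom}_{\mathbb Z}(N,\mathbb{Z})$, let $N_{\mathbb Q}=N\otimes\mathbb{Q}$ and $M_{\mathbb Q}=M\otimes\mathbb{Q}$, and let $\langle\cdot,\cdot\rangle$ be the pairing between $N_{\mathbb Q}$ and $M_{\mathbb Q}$. Let $P\subset N_{\mathbb Q}$ be a reflexive polytope of dimension $n$: a lattice polytope with the origin in its interior whose dual $P^*=\{y\in M_{\mathbb Q} : \langle x,y\rangle\ge -1 \text{ for all } x\in P\}$ is a lattice polytope with respect to $M$. Assume that $P$ is simplicial: the vertices of every facet of $P$ are linearly independent. Write $V(P)$ and $V(P^*)$ for the sets of vertices, let $F_u=\{x\in P : \langle x,u\rangle=-1\}$ for $u\in V(P^*)$, and let $$\delta_P=\min\{\langle v,u\rangle : v\in V(P),\ u\in V(P^*),\ v\notin F_u\}\in\mathbb{Z}_{\ge 0}.$$ Let $X_P$ be the toric variety whose fan consists of the cones over the proper faces of $P$, and let $S_3$ be the blow-up of $\mathbb{P}^2$ at its three torus-fixed points. Then: (i) $|V(P)|\le 3n$, with equality if and only if $n$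 is even and $X_P\cong (S_3)^{n/2}$ as toric varieties, that is, there is an isomorphism $N\to(\mathbb{Z}^2)^{n/2}$ of lattices that carries the fan of $X_P$ onto the fan of $(S_3)^{n/2}$. (ii) If $\delta_P>0$, then $|V(P)|\le n+\frac{n}{\delta_P}$. Equality holds if and only if $r=\frac{n}{\delta_P}$ is an integer and there are $Q_1,\dots,Q_r\subset N_{\mathbb Q}$ such that $P=\operatorname{Conv}(Q_1\cup\dots\cup Q_r)$, each $Q_j$ is a simplex of dimension $\delta_P$ whose vertices have sum zero and which is a reflexive polytope in its linear span $H_j$ with respect to the lattice $N\cap H_j$, and $N_{\mathbb Q}=H_1\oplus\cdots\oplus H_r$. -/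

import Mathlib

/-! Lattice polytopes in a finite-dimensional rational vector space `V` (the space `N_ℚ`) with a
lattice `L` in it (the lattice `N`). The dual space is `Module.Dual ℚ V` (the space `M_ℚ`), and the
pairing `⟨x, y⟩` is the evaluation `y x`. -/

namespace FanoPolytope

section Polytope

variable {V : Type*} [AddCommGroup V] [Module ℚ V]

/-- The dual lattice `M = Hom(N, ℤ)` inside `M_ℚ`: the functionals that are integral on `L`. -/
def dualLattice (L : Submodule ℤ V) : Submodule ℤ (Module.Dual ℚ V) where
  carrier := {y | ∀ x ∈ L, ∃ k : ℤ, y x = k}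
  add_mem' := by
    intro y z hy hz x hx
    obtain ⟨a, ha⟩ := hy x hx
    obtain ⟨b, hb⟩ := hz x hx
    exact ⟨a + b, by rw [LinearMap.add_apply, ha, hb, Int.cast_add]⟩
  zero_mem' := fun x _ => ⟨0, by simp⟩
  smul_mem' := by
    intro c y hy x hx
    obtain ⟨a, ha⟩ := hy x hx
    exact ⟨c * a, by simp [ha]⟩

/-- `P` is a lattice polytope: the convex hull of finitely many lattice points. -/
def IsLatticePolytope (L : Submodule ℤ V) (P : Set V) : Prop :=
  ∃ S : Finset V, (S : Set V) ⊆ L ∧ P = convexHull ℚ (S : Set V)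

/-- The origin is an interior point of `P`: one can move from it a little in every direction
without leaving `P`. For a convex subset of a finite-dimensional space this is the same as
being in the topological interior. -/
def ZeroInInterior (P : Set V) : Prop :=
  ∀ v : V, ∃ ε : ℚ, 0 < ε ∧ ∀ t : ℚ, 0 ≤ t → t ≤ ε → t • v ∈ P

/-- The dual polytope `P^* = {y | ⟨x, y⟩ ≥ -1 for all x ∈ P}`. -/
def dualPolytope (P : Set V) : Set (Module.Dual ℚ V) :=
  {y | ∀ x ∈ P, -1 ≤ y x}

/-- `P` is a reflexive polytope in `V` with respect to the lattice `L`: a lattice polytope with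
the origin in its interior (so it has full dimension) whose dual is a lattice polytope. -/
structure IsReflexive (L : Submodule ℤ V) (P : Set V) : Prop where
  isLatticePolytope : IsLatticePolytope L P
  zeroInInterior : ZeroInInterior P
  isLatticePolytope_dual : IsLatticePolytope (dualLattice L) (dualPolytope P)

/-- The set `V(P)` of vertices. -/
def vertices (P : Set V) : Set V := P.extremePoints ℚ

/-- `F` is a face of `P` (the empty set and `P` itself are allowed): the set of points of `P` where
some affine inequality `c ≤ f x` that is valid on `P` is an equality. -/
def IsFace (P F : Set V) : Prop :=
  ∃ (f : Module.Dual ℚ V) (c : ℚ), (∀ x ∈ P, c ≤ f x) ∧ F = {x ∈ P | f x = c}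

/-- `F` is a facet of `P`: a nonempty face with `dim F = dim P - 1`. -/
def IsFacet (P F : Set V) : Prop :=
  IsFace P F ∧ F.Nonempty ∧
    Module.finrank ℚ (vectorSpan ℚ F) + 1 = Module.finrank ℚ (vectorSpan ℚ P)

/-- `P` is simplicial: the vertices of every facet are linearly independent. -/
def IsSimplicial (P : Set V) : Prop :=
  ∀ F : Set V, IsFacet P F → LinearIndepOn ℚ id (vertices F)

/-- The face `F_u = {x ∈ P | ⟨x, u⟩ = -1}`. -/
def dualFacet (P : Set V) (u : Module.Dual ℚ V) : Set V := {x ∈ P | u x = -1}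

/-- `δ_P = min {⟨v, u⟩ | v ∈ V(P), u ∈ V(P^*), v ∉ F_u}`. When `P` is reflexive, all the `⟨v, u⟩`
that occur are nonnegative integers (an integer that is at least `-1` and is not `-1`), so that the
minimum can be taken over the natural numbers. -/
noncomputable def delta (P : Set V) : ℕ :=
  sInf {k : ℕ | ∃ v ∈ vertices P, ∃ u ∈ vertices (dualPolytope P),
    v ∉ dualFacet P u ∧ u v = (k : ℚ)}

/-- `Q` is a simplex of dimension `d`. -/
def IsSimplex (d : ℕ) (Q : Set V) : Prop :=
  ∃ p : Fin (d + 1) → V, AffineIndependent ℚ p ∧ Q = convexHull ℚ (Set.range p)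

/-- `Q ⊆ V` is reflexive as a polytope in its linear span `H`, with respect to the lattice `L ∩ H`
of `H`. -/
def IsReflexiveInSpan (L : Submodule ℤ V) (Q : Set V) : Prop :=
  IsReflexive (V := Submodule.span ℚ Q)
    (L.comap ((Submodule.span ℚ Q).subtype.restrictScalars ℤ))
    ((↑) ⁻¹' Q : Set (Submodule.span ℚ Q))

end Polytope

/-! Toric varieties are described by their fans: a fan in `V` is given as the set of its cones, and
an isomorphism of toric varieties is an isomorphism of lattices that carries the one fan onto the
other. -/

section Fan

variable {V : Type*} [AddCommGroup V] [Module ℚ V] {W : Type*} [AddCommGroup W] [Module ℚ W]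

/-- The fan of the toric variety `X_P`: the cones over the proper faces of `P` (the cone over the
empty face is `{0}`). -/
def faceFan (P : Set V) : Set (PointedCone ℚ V) :=
  {σ | ∃ F : Set V, IsFace P F ∧ F ≠ P ∧ σ = PointedCone.hull ℚ F}

/-- The toric varieties with fan `A` (for the lattice `L` in `V`) and fan `B` (for the lattice `K`
in `W`) are isomorphic. -/
def ToricIso (L : Submodule ℤ V) (A : Set (PointedCone ℚ V))
    (K : Submodule ℤ W) (B : Set (PointedCone ℚ W)) : Prop :=
  ∃ φ : V ≃ₗ[ℚ] W, L.map (φ.toLinearMap.restrictScalars ℤ) = K ∧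
    (fun σ => PointedCone.map φ.toLinearMap σ) '' A = B

/-- The fan of the blow-up of a toric surface at the torus-fixed point that belongs to the cone
spanned by a lattice basis `a, b`: this cone is cut in two by the ray through `a + b`. -/
def blowUpFan (A : Set (PointedCone ℚ V)) (a b : V) : Set (PointedCone ℚ V) :=
  (A \ {PointedCone.hull ℚ {a, b}}) ∪
    {PointedCone.hull ℚ {a, a + b}, PointedCone.hull ℚ {a + b}, PointedCone.hull ℚ {a + b, b}}

/-- The ray generators `e₁, e₂, -e₁ - e₂` of the fan of the projective plane. -/
def planeRay : Fin 3 → (Fin 2 → ℚ) := ![![1, 0], ![0, 1], ![-1, -1]]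

/-- The fan of the projective plane: the cones spanned by the proper subsets of
`{e₁, e₂, -e₁ - e₂}`. -/
def planeFan : Set (PointedCone ℚ (Fin 2 → ℚ)) :=
  {σ | ∃ s : Set (Fin 3), s ≠ Set.univ ∧ σ = PointedCone.hull ℚ (planeRay '' s)}

/-- The fan of `S₃`, the blow-up of the projective plane at three non collinear points (the three
torus-fixed points). -/
def s3Fan : Set (PointedCone ℚ (Fin 2 → ℚ)) :=
  blowUpFan (blowUpFan (blowUpFan planeFan
    (planeRay 0) (planeRay 1)) (planeRay 1) (planeRay 2)) (planeRay 2) (planeRay 0)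

/-- The lattice `ℤ²` in `ℚ²`. -/
def planeLattice : Submodule ℤ (Fin 2 → ℚ) :=
  Submodule.span ℤ (Set.range fun i : Fin 2 => Pi.single i (1 : ℚ))

/-- The lattice `(ℤ²)^m` of the `m`-fold product of toric surfaces. -/
def s3PowLattice (m : ℕ) : Submodule ℤ (Fin m → Fin 2 → ℚ) :=
  Submodule.pi Set.univ fun _ => planeLattice

/-- The fan of the `m`-fold product `(S₃)^m`: its cones are the products of `m` cones of the fan of
`S₃`. -/
def s3PowFan (m : ℕ) : Set (PointedCone ℚ (Fin m → Fin 2 → ℚ)) :=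
  {σ | ∃ τ : Fin m → PointedCone ℚ (Fin 2 → ℚ), (∀ i, τ i ∈ s3Fan) ∧
    σ = Submodule.pi Set.univ τ}

end Fan

end FanoPolytope

/-! Let `A` and `B` be the vertex sets of a simplicial reflexive polytope `P` of dimension `n` and of
its dual. The numbers `u v` with `u ∈ B`, `v ∈ A` are integers `≥ -1`, and since the facets are
simplices, the value `-1` (level `-1` of `u`) is taken exactly `n` times for each `u`; these vertices
are a basis of the space.

All bounds come from evaluating dual vertices at the sum of the vertices of `P`. The origin is a
combination of all `u ∈ B` with positive weights, so `∑ v ∈ A, u v ≤ 0` for some `u`, and if these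
sums are nonnegative for all `u`, then they all vanish (`sum_apply_vertices_eq_zero`). If all values
other than `-1` are at least `δ`, then `∑ v ∈ A, u v ≥ -n + δ (|A| - n)`, whence
`|A| ≤ n + n / δ`. For the bound `3n`, one needs in addition that there are at most `n` vertices of
level `0` (`card_levelZero_le`). For this, let `c` be the coordinate function of a vertex `e` of the
facet of `u`. The neighbouring facet opposite to `e` belongs to `u + γ c` for some `γ > 0`, and it has
just one new vertex (`exists_neighbour`). A vertex of level `0` has some negative coordinate, hence
negative integral value at such a `u + γ c`, so it is that new vertex.

In the case of equality, all these estimates are equalities, for every `u`. In the second part, only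
the values `-1` and `δ` occur. Comparing `u` with its neighbours, `γ = δ + 1`, and every vertex
outside the facet is the negative of a sum of `δ` vertices of the facet, where different vertices
involve disjoint sets: `P` is a free sum of simplices (`exists_simplices`). Each of them is both a
section and a projection of `P`, so it is reflexive. Conversely all vertices of the summands of a
free sum are vertices (`le_ncard_vertices_of_simplices`).

In the first part, the values are `-1, 0, 1`, each taken `n` times, and `P` is centrally symmetric.
The vertices of level `0` correspond to the vertices of the facet by the position of their
negative coordinate. Since they come in pairs `z, -z`, they also have only one positive coordinate,
and they turn out to be `σ e - e` for an involution `σ` of the vertices of the facet without fixed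
points (`exists_involution`). So `P` is a free sum of hexagons in a lattice basis. Its fan is
computed through the dual polytope: a cone is generated by the vertices on which a functional `≥ -1`
takes the value `-1` (`mem_faceFan`), and for a free sum this description splits into the summands.
Conversely each of the `3n` rays of the fan of the product contains a vertex of `P`
(`le_card_of_toricIso`). -/

namespace FanoPolytope

/-! ### Extreme points of rational polytopes -/

section Convexity

variable {V : Type*} [AddCommGroup V] [Module ℚ V]

/-- A generator of a convex hull that is not an extreme point is redundant. -/
theorem mem_convexHull_diff_of_notMem_extremePoints {S : Set V} {x : V} (hx : x ∈ S)
    (h : x ∉ (convexHull ℚ S).extremePoints ℚ) : x ∈ convexHull ℚ (S \ {x}) := by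
  have hxS : x ∈ convexHull ℚ S := subset_convexHull ℚ S hx
  rcases (S \ {x}).eq_empty_or_nonempty with he | hne
  · have : S = {x} := by
      apply Set.Subset.antisymm
      · exact Set.sdiff_eq_empty.1 he
      · simpa using hx
    rw [this] at h
    simp at h
  have hS : S = insert x (S \ {x}) := by simp [Set.insert_eq_of_mem hx]
  rw [mem_extremePoints] at h
  push Not at h
  obtain ⟨y, hy, z, hz, hxyz, hne'⟩ := h hxS
  rw [hS, convexHull_insert hne, convexJoin_singleton_left] at hy hz
  simp only [Set.mem_iUnion] at hy hz
  obtain ⟨y', hy', a, b, ha, hb, hab, rfl⟩ := hy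
  obtain ⟨z', hz', c, d, hc, hd, hcd, rfl⟩ := hz
  obtain ⟨s, t, hs, ht, hst, hx'⟩ := hxyz
  -- the weight that the combination puts on generators other than `x`
  have hpos : 0 < s * b + t * d := by
    by_contra hcon
    have h1 : 0 ≤ s * b := by positivity
    have h2 : 0 ≤ t * d := by positivity
    have hb0 : b = 0 := by
      have : s * b = 0 := by linarith
      rcases mul_eq_zero.1 this with h | h
      · linarith
      · exact h
    have hd0 : d = 0 := by
      have : t * d = 0 := by linarith
      rcases mul_eq_zero.1 this with h | h
      · linarith
      · exact h
    have ha1 : a = 1 := by linarith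
    have hc1 : c = 1 := by linarith
    apply hne' <;> simp [hb0, hd0, ha1, hc1]
  have key : x = (s * b / (s * b + t * d)) • y' + (t * d / (s * b + t * d)) • z' := by
    have e : (s * b + t * d) • x = (s * b) • y' + (t * d) • z' := by
      have e1 : (s * a + t * c) • x + ((s * b) • y' + (t * d) • z') = x := by
        conv_rhs => rw [← hx']
        module
      have e2 : s * a + t * c = 1 - (s * b + t * d) := by
        have : a = 1 - b := by linarith
        have : c = 1 - d := by linarith
        subst a c
        linear_combination hst
      rw [e2] at e1
      rw [sub_smul, one_smul] at e1
      have e3 := sub_eq_zero.2 e1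
      rw [eq_comm, ← sub_eq_zero, ← e3]
      abel
    rw [div_eq_inv_mul, div_eq_inv_mul, mul_smul _ (s * b), mul_smul _ (t * d), ← smul_add, ← e,
      smul_smul, inv_mul_cancel₀ hpos.ne', one_smul]
  have hmem : (s * b / (s * b + t * d)) • y' + (t * d / (s * b + t * d)) • z' ∈
      convexHull ℚ (S \ {x}) := by
    apply convex_convexHull ℚ _ hy' hz'
    · positivity
    · positivity
    · field_simp
  rwa [← key] at hmem

/-- A rational polytope is the convex hull of its extreme points. -/
theorem convexHull_extremePoints_convexHull (S : Finset V) :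
    convexHull ℚ ((convexHull ℚ (S : Set V)).extremePoints ℚ) = convexHull ℚ (S : Set V) := by
  classical
  induction S using Finset.strongInduction with
  | H S ih =>
    by_cases h : ∀ x ∈ S, x ∈ (convexHull ℚ (S : Set V)).extremePoints ℚ
    · exact Set.Subset.antisymm
        (convexHull_min extremePoints_subset (convex_convexHull ℚ _))
        (convexHull_mono h)
    · push Not at h
      obtain ⟨x, hx, hx'⟩ := h
      have h1 := mem_convexHull_diff_of_notMem_extremePoints (S := (S : Set V)) hx hx'
      have h2 : convexHull ℚ (S : Set V) = convexHull ℚ ((S.erase x : Finset V) : Set V) := by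
        rw [Finset.coe_erase]
        apply Set.Subset.antisymm
        · apply convexHull_min _ (convex_convexHull ℚ _)
          intro y hy
          by_cases hyx : y = x
          · rwa [hyx]
          · exact subset_convexHull ℚ _ ⟨hy, hyx⟩
        · exact convexHull_mono Set.sdiff_subset
      rw [h2]
      exact ih _ (Finset.erase_ssubset hx)

/-- The unique maximizer of a linear functional on a generating set is an extreme point. -/
theorem mem_extremePoints_convexHull_of_lt {S : Set V} {v : V} (hv : v ∈ S)
    (f : Module.Dual ℚ V) (hf : ∀ x ∈ S, x ≠ v → f x < f v) :
    v ∈ (convexHull ℚ S).extremePoints ℚ := by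
  by_contra h
  have h1 := mem_convexHull_diff_of_notMem_extremePoints hv h
  have h2 : convexHull ℚ (S \ {v}) ⊆ {x | f x < f v} :=
    convexHull_min (fun x hx => hf x hx.1 hx.2) (convex_halfSpace_lt f.isLinear _)
  exact lt_irrefl (f v) (h2 h1)

/-- Finitely many strict inequalities `0 < b x` leave room for a small multiple of `a`. -/
theorem exists_pos_forall_mul_le {α : Type*} (s : Finset α) (a b : α → ℚ)
    (hb : ∀ x ∈ s, 0 < b x) : ∃ ε : ℚ, 0 < ε ∧ ∀ x ∈ s, ε * a x ≤ b x := by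
  classical
  induction s using Finset.induction_on with
  | empty => exact ⟨1, one_pos, by simp⟩
  | insert y s hy ih =>
    obtain ⟨ε, hε, h⟩ := ih fun x hx => hb x (Finset.mem_insert_of_mem hx)
    have hby := hb y (Finset.mem_insert_self _ _)
    have hay : 0 < |a y| + 1 := by positivity
    have hy0 : 0 < b y / (|a y| + 1) := by positivity
    have hmin : 0 < min ε (b y / (|a y| + 1)) := lt_min hε hy0
    refine ⟨min ε (b y / (|a y| + 1)), hmin, ?_⟩
    intro x hx
    rcases Finset.mem_insert.1 hx with rfl | hx'
    · calc _ ≤ min ε (b x / (|a x| + 1)) * (|a x| + 1) := by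
            apply mul_le_mul_of_nonneg_left _ hmin.le
            linarith [le_abs_self (a x)]
        _ ≤ b x / (|a x| + 1) * (|a x| + 1) :=
            mul_le_mul_of_nonneg_right (min_le_right _ _) hay.le
        _ = b x := by field_simp
    · rcases le_or_gt 0 (a x) with h0 | h0
      · exact (mul_le_mul_of_nonneg_right (min_le_left _ _) h0).trans (h x hx')
      · exact (mul_nonpos_of_nonneg_of_nonpos hmin.le h0.le).trans
          (hb x (Finset.mem_insert_of_mem hx')).le

end Convexity

/-! ### Vertices and dual vertices of a simplicial reflexive polytope -/

section Pair

variable {V : Type*} [AddCommGroup V] [Module ℚ V]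

/-- The elements of `A` on which `u` takes the value `-1`. If `A` is the vertex set of a polytope
and `u` a vertex of the dual polytope, these are the vertices of the facet `F_u`. -/
def tight (A : Finset V) (u : Module.Dual ℚ V) : Finset V := A.filter fun v => u v = -1

theorem mem_tight {A : Finset V} {u : Module.Dual ℚ V} {v : V} :
    v ∈ tight A u ↔ v ∈ A ∧ u v = -1 := Finset.mem_filter

/-- The elements of `A` of level `0` with respect to `u`. -/
def levelZero (A : Finset V) (u : Module.Dual ℚ V) : Finset V := A.filter fun v => u v = 0

theorem mem_levelZero {A : Finset V} {u : Module.Dual ℚ V} {v : V} :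
    v ∈ levelZero A u ↔ v ∈ A ∧ u v = 0 := Finset.mem_filter

/-- The finite data behind a simplicial reflexive polytope: `A` stands for its vertex set and `B`
for the vertex set of its dual. The elements of `B` are the functionals `u ≥ -1` on `A` whose tight
points span the space, and these tight points then form a basis. The field `exists_neg` says that
the origin is an interior point of the polytope, and `balance` says that it is a combination of the
dual vertices in which all of them have positive weight. -/
structure IsSimplicialPair (A : Finset V) (B : Finset (Module.Dual ℚ V)) : Prop where
  integral : ∀ u ∈ B, ∀ v ∈ A, ∃ k : ℤ, u v = k
  neg_one_le : ∀ u ∈ B, ∀ v ∈ A, -1 ≤ u v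
  mem_of_span : ∀ u : Module.Dual ℚ V, (∀ v ∈ A, -1 ≤ u v) →
    Submodule.span ℚ (tight A u : Set V) = ⊤ → u ∈ B
  span_tight : ∀ u ∈ B, Submodule.span ℚ (tight A u : Set V) = ⊤
  linearIndepOn : ∀ u ∈ B, LinearIndepOn ℚ id (tight A u : Set V)
  exists_neg : ∀ y : Module.Dual ℚ V, y ≠ 0 → ∃ v ∈ A, y v < 0
  zero_notMem : (0 : V) ∉ A
  nonempty : B.Nonempty
  balance : ∃ m : Module.Dual ℚ V → ℚ, (∀ u ∈ B, 0 < m u) ∧ ∑ u ∈ B, m u • u = 0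

theorem zero_mem_of_zeroInInterior {P : Set V} (h : ZeroInInterior P) : (0 : V) ∈ P := by
  obtain ⟨ε, hε, h⟩ := h 0
  simpa using h 0 le_rfl hε.le

theorem zero_notMem_vertices [Nontrivial V] {P : Set V} (h : ZeroInInterior P) :
    (0 : V) ∉ vertices P := by
  intro h0
  rw [vertices, mem_extremePoints_iff_left] at h0
  obtain ⟨w, hw⟩ := exists_ne (0 : V)
  obtain ⟨a, ha, hwa⟩ := h w
  obtain ⟨b, hb, hwb⟩ := h (-w)
  have hab : 0 < min a b := lt_min ha hb
  have := h0.2 _ (hwa _ hab.le (min_le_left _ _)) _ (hwb _ hab.le (min_le_right _ _))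
    ⟨1 / 2, 1 / 2, by norm_num, by norm_num, by norm_num, by module⟩
  rcases smul_eq_zero.1 this with h | h
  · exact hab.ne' h
  · exact hw h

theorem vectorSpan_eq_top_of_zeroInInterior {P : Set V} (h : ZeroInInterior P) :
    vectorSpan ℚ P = ⊤ := by
  rw [eq_top_iff]
  intro v _
  obtain ⟨ε, hε, hv⟩ := h v
  have h1 : ε • v - 0 ∈ vectorSpan ℚ P :=
    vsub_mem_vectorSpan ℚ (hv ε hε.le le_rfl) (zero_mem_of_zeroInInterior h)
  have h2 := (vectorSpan ℚ P).smul_mem ε⁻¹ h1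
  rwa [sub_zero, smul_smul, inv_mul_cancel₀ hε.ne', one_smul] at h2

theorem IsLatticePolytope.finite_vertices {L : Submodule ℤ V} {P : Set V}
    (h : IsLatticePolytope L P) : (vertices P).Finite := by
  obtain ⟨S, -, rfl⟩ := h
  exact S.finite_toSet.subset extremePoints_convexHull_subset

theorem IsLatticePolytope.vertices_subset {L : Submodule ℤ V} {P : Set V}
    (h : IsLatticePolytope L P) : vertices P ⊆ L := by
  obtain ⟨S, hS, rfl⟩ := h
  exact extremePoints_convexHull_subset.trans hS

theorem IsLatticePolytope.convexHull_vertices {L : Submodule ℤ V} {P : Set V}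
    (h : IsLatticePolytope L P) : convexHull ℚ (vertices P) = P := by
  obtain ⟨S, hS, rfl⟩ := h
  exact convexHull_extremePoints_convexHull S

theorem mem_dualPolytope_convexHull {A : Set V} {u : Module.Dual ℚ V} :
    u ∈ dualPolytope (convexHull ℚ A) ↔ ∀ v ∈ A, -1 ≤ u v := by
  constructor
  · intro h v hv
    exact h v (subset_convexHull ℚ _ hv)
  · intro h x hx
    have : convexHull ℚ A ⊆ {x | -1 ≤ u x} :=
      convexHull_min h (convex_halfSpace_ge u.isLinear _)
    exact this hx

/-- A point of the dual polytope whose tight points span the space is a vertex. -/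
theorem mem_vertices_dualPolytope {A : Finset V} {u : Module.Dual ℚ V}
    (hu : ∀ v ∈ A, -1 ≤ u v) (hspan : Submodule.span ℚ (tight A u : Set V) = ⊤) :
    u ∈ vertices (dualPolytope (convexHull ℚ (A : Set V))) := by
  rw [vertices, mem_extremePoints_iff_left]
  refine ⟨mem_dualPolytope_convexHull.2 hu, ?_⟩
  intro x hx y hy hxy
  rw [mem_dualPolytope_convexHull] at hx hy
  obtain ⟨a, b, ha, hb, hab, rfl⟩ := hxy
  apply LinearMap.ext_on hspan
  intro v hv
  obtain ⟨hvA, hv1⟩ := mem_tight.1 hv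
  rw [hv1]
  have h1 := hx v hvA
  have h2 := hy v hvA
  simp only [LinearMap.add_apply, LinearMap.smul_apply, smul_eq_mul] at hv1
  have hb' : b = 1 - a := by linarith
  subst hb'
  have : a * (x v + 1) = 0 := by
    have h3 : 0 ≤ a * (x v + 1) := mul_nonneg ha.le (by linarith)
    have h4 : 0 ≤ (1 - a) * (y v + 1) := mul_nonneg hb.le (by linarith)
    linarith
  rcases mul_eq_zero.1 this with h | h
  · linarith
  · linarith

/-- The tight points of a vertex of the dual polytope span the space. -/
theorem span_tight_eq_top {A : Finset V} {u : Module.Dual ℚ V}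
    (hu : u ∈ vertices (dualPolytope (convexHull ℚ (A : Set V)))) :
    Submodule.span ℚ (tight A u : Set V) = ⊤ := by
  classical
  by_contra hne
  obtain ⟨g, hg0, hg⟩ := Submodule.exists_le_ker_of_lt_top _ (lt_top_iff_ne_top.2 hne)
  rw [vertices, mem_extremePoints_iff_left] at hu
  obtain ⟨hu1, hu2⟩ := hu
  rw [mem_dualPolytope_convexHull] at hu1
  -- `g` vanishes on the tight points, so `u` can be moved along `g` in both directions
  obtain ⟨ε, hε, h⟩ := exists_pos_forall_mul_le (A \ tight A u) (fun v => |g v|)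
    (fun v => 1 + u v) (by
      intro v hv
      rw [Finset.mem_sdiff, mem_tight] at hv
      have h1 := hu1 v hv.1
      have h2 : u v ≠ -1 := fun h => hv.2 ⟨hv.1, h⟩
      have := lt_of_le_of_ne h1 h2.symm
      linarith)
  have hmem : ∀ c : ℚ, |c| = ε → u + c • g ∈ dualPolytope (convexHull ℚ (A : Set V)) := by
    intro c hc
    rw [mem_dualPolytope_convexHull]
    intro v hv
    rw [LinearMap.add_apply, LinearMap.smul_apply, smul_eq_mul]
    by_cases hvt : v ∈ tight A u
    · have : g v = 0 := hg (Submodule.subset_span hvt)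
      rw [this, mul_zero, add_zero]
      exact hu1 v hv
    · have h1 := h v (Finset.mem_sdiff.2 ⟨hv, hvt⟩)
      have h2 := neg_abs_le (c * g v)
      rw [abs_mul, hc] at h2
      linarith
  have := hu2 _ (hmem ε (abs_of_pos hε)) _ (hmem (-ε) (by rw [abs_neg, abs_of_pos hε]))
    ⟨1 / 2, 1 / 2, by norm_num, by norm_num, by norm_num, by module⟩
  have h0 : ε • g = 0 := by simpa using this
  rcases smul_eq_zero.1 h0 with h | h
  · exact hε.ne' h
  · exact hg0 h

theorem isExtreme_dualFacet {P : Set V} {u : Module.Dual ℚ V} (hu : u ∈ dualPolytope P) :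
    IsExtreme ℚ P (dualFacet P u) := by
  refine ⟨fun x hx => hx.1, ?_⟩
  rintro x hx y hy z ⟨hz, hz1⟩ ⟨a, b, ha, hb, hab, rfl⟩
  refine ⟨hx, ?_⟩
  have h1 := hu x hx
  have h2 := hu y hy
  simp only [map_add, map_smul, smul_eq_mul] at hz1
  have hb' : b = 1 - a := by linarith
  subst hb'
  have : a * (u x + 1) = 0 := by
    have h3 : 0 ≤ a * (u x + 1) := mul_nonneg ha.le (by linarith)
    have h4 : 0 ≤ (1 - a) * (u y + 1) := mul_nonneg hb.le (by linarith)
    linarith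
  rcases mul_eq_zero.1 this with h | h
  · linarith
  · linarith

/-- A face `F_u` whose points span the whole space is a facet. -/
theorem isFacet_dualFacet [Module.Finite ℚ V] {P : Set V} (h0 : ZeroInInterior P)
    {u : Module.Dual ℚ V} (hu : u ∈ dualPolytope P)
    (hne : (dualFacet P u).Nonempty) (hspan : Submodule.span ℚ (dualFacet P u) = ⊤) :
    IsFacet P (dualFacet P u) := by
  refine ⟨⟨u, -1, hu, rfl⟩, hne, ?_⟩
  rw [vectorSpan_eq_top_of_zeroInInterior h0, finrank_top]
  obtain ⟨p, hp⟩ := hne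
  have hu0 : u ≠ 0 := by
    rintro rfl
    have := hp.2
    norm_num at this
  have h1 : vectorSpan ℚ (dualFacet P u) ≤ LinearMap.ker u := by
    rw [vectorSpan_def, Submodule.span_le]
    rintro _ ⟨x, hx, y, hy, rfl⟩
    simp [hx.2, hy.2]
  have h2 : (⊤ : Submodule ℚ V) ≤ vectorSpan ℚ (dualFacet P u) ⊔ Submodule.span ℚ {p} := by
    rw [← hspan, Submodule.span_le]
    intro x hx
    have : x = (x - p) + p := by abel
    rw [this]
    exact Submodule.add_mem_sup (vsub_mem_vectorSpan ℚ hx hp) (Submodule.mem_span_singleton_self p)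
  have h3 := Submodule.finrank_mono h1
  have h4 := Module.Dual.finrank_ker_add_one_of_ne_zero hu0
  have h5 := Submodule.finrank_mono h2
  have h6 := Submodule.finrank_add_le_finrank_add_finrank
    (vectorSpan ℚ (dualFacet P u)) (Submodule.span ℚ {p})
  have h7 : Module.finrank ℚ (Submodule.span ℚ {p}) ≤ 1 := by
    simpa using finrank_span_le_card (R := ℚ) ({p} : Set V)
  rw [finrank_top] at h5
  omega

/-- The vertices of a simplicial reflexive polytope and of its dual form a simplicial pair. -/
theorem isSimplicialPair_vertices [Module.Finite ℚ V] [Nontrivial V] {L : Submodule ℤ V} {P : Set V}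
    (hP : IsReflexive L P) (hs : IsSimplicial P) {A : Finset V} {B : Finset (Module.Dual ℚ V)}
    (hA : (A : Set V) = vertices P) (hB : (B : Set (Module.Dual ℚ V)) = vertices (dualPolytope P)) :
    IsSimplicialPair A B := by
  have hPA : P = convexHull ℚ (A : Set V) := by
    rw [hA, hP.isLatticePolytope.convexHull_vertices]
  have hdual : ∀ u, u ∈ dualPolytope P ↔ ∀ v ∈ A, -1 ≤ u v := by
    intro u
    rw [hPA]
    exact mem_dualPolytope_convexHull
  have hBP : ∀ u ∈ B, u ∈ dualPolytope P := fun u hu => by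
    have : u ∈ (B : Set _) := hu
    rw [hB] at this
    exact extremePoints_subset this
  have hspan : ∀ u ∈ B, Submodule.span ℚ (tight A u : Set V) = ⊤ := by
    intro u hu
    apply span_tight_eq_top
    rw [← hPA, ← hB]
    exact hu
  have htight : ∀ u, (tight A u : Set V) ⊆ dualFacet P u := by
    intro u v hv
    obtain ⟨h1, h2⟩ := mem_tight.1 hv
    exact ⟨by rw [hPA]; exact subset_convexHull ℚ _ h1, h2⟩
  have hnonempty : B.Nonempty := by
    have h0 : (0 : Module.Dual ℚ V) ∈ convexHull ℚ (B : Set (Module.Dual ℚ V)) := by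
      rw [hB, hP.isLatticePolytope_dual.convexHull_vertices, hdual]
      intro v hv
      simp
    exact Finset.coe_nonempty.1 (convexHull_nonempty_iff.1 ⟨0, h0⟩)
  refine ⟨?_, fun u hu => (hdual u).1 (hBP u hu), ?_, hspan, ?_, ?_, ?_, hnonempty, ?_⟩
  · intro u hu v hv
    have h1 : u ∈ dualLattice L := hP.isLatticePolytope_dual.vertices_subset (hB ▸ hu)
    exact h1 v (hP.isLatticePolytope.vertices_subset (hA ▸ hv))
  · intro u hu h
    have := mem_vertices_dualPolytope hu h
    rw [← hPA, ← hB] at this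
    exact this
  · intro u hu
    have hne : (tight A u).Nonempty := by
      rw [Finset.nonempty_iff_ne_empty]
      intro he
      have := hspan u hu
      rw [he, Finset.coe_empty, Submodule.span_empty] at this
      exact bot_ne_top this
    have hfacet : IsFacet P (dualFacet P u) := by
      apply isFacet_dualFacet hP.zeroInInterior (hBP u hu)
      · exact (Finset.coe_nonempty.2 hne).mono (htight u)
      · rw [eq_top_iff, ← hspan u hu]
        exact Submodule.span_mono (htight u)
    refine (hs _ hfacet).mono ?_
    rw [vertices, (isExtreme_dualFacet (hBP u hu)).extremePoints_eq]
    intro v hv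
    refine ⟨htight u hv, ?_⟩
    have : v ∈ (A : Set V) := (mem_tight.1 hv).1
    rwa [hA] at this
  · intro y hy
    by_contra hcon
    push Not at hcon
    have hnn : P ⊆ {x | 0 ≤ y x} := by
      rw [hPA]
      exact convexHull_min hcon (convex_halfSpace_ge y.isLinear _)
    apply hy
    have hle : ∀ w, 0 ≤ y w := by
      intro w
      obtain ⟨ε, hε, h⟩ := hP.zeroInInterior w
      have := hnn (h ε hε.le le_rfl)
      simp only [Set.mem_ofPred_eq, map_smul, smul_eq_mul] at this
      exact nonneg_of_mul_nonneg_right this hε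
    ext w
    have h1 := hle w
    have h2 := hle (-w)
    rw [map_neg] at h2
    rw [LinearMap.zero_apply]
    linarith
  · intro h0
    apply zero_notMem_vertices hP.zeroInInterior
    rw [← hA]
    exact h0
  · obtain ⟨ε, hε, h⟩ := exists_pos_forall_mul_le A (fun v => (∑ u ∈ B, u) v) (fun _ => 1)
      (fun _ _ => one_pos)
    have hmem : -(ε • ∑ u ∈ B, u) ∈ convexHull ℚ (B : Set (Module.Dual ℚ V)) := by
      rw [hB, hP.isLatticePolytope_dual.convexHull_vertices, hdual]
      intro v hv
      have := h v hv
      rw [LinearMap.neg_apply, LinearMap.smul_apply, smul_eq_mul]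
      linarith
    obtain ⟨w, hw0, -, hw⟩ := Finset.mem_convexHull'.1 hmem
    refine ⟨fun u => w u + ε, fun u hu => add_pos_of_nonneg_of_pos (hw0 u hu) hε, ?_⟩
    simp only [add_smul, Finset.sum_add_distrib]
    rw [hw, Finset.smul_sum, neg_add_cancel]

end Pair

section Neighbour

variable {V : Type*} [AddCommGroup V] [Module ℚ V]
variable {A : Finset V} {B : Finset (Module.Dual ℚ V)}

namespace IsSimplicialPair

/-! ### The basis of a facet and the neighbouring facets -/

/-- The vertices of the facet `F_u`, as a basis of the space. -/
noncomputable def basis (h : IsSimplicialPair A B) {u : Module.Dual ℚ V} (hu : u ∈ B) :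
    Module.Basis (tight A u) ℚ V :=
  Module.Basis.mk (v := fun e : tight A u => (e : V)) (h.linearIndepOn u hu) (by
    rw [← h.span_tight u hu]
    apply Submodule.span_mono
    intro v hv
    exact ⟨⟨v, hv⟩, rfl⟩)

@[simp]
theorem basis_apply (h : IsSimplicialPair A B) {u : Module.Dual ℚ V} (hu : u ∈ B)
    (e : tight A u) : h.basis hu e = e := by
  exact Module.Basis.mk_apply _ _ _

theorem coord_self (h : IsSimplicialPair A B) {u : Module.Dual ℚ V} (hu : u ∈ B)
    (e : tight A u) : (h.basis hu).coord e e = 1 := by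
  classical
  have := (h.basis hu).repr_self_apply e e
  rwa [if_pos rfl, basis_apply] at this

theorem coord_of_ne (h : IsSimplicialPair A B) {u : Module.Dual ℚ V} (hu : u ∈ B)
    {e e' : tight A u} (hne : e' ≠ e) : (h.basis hu).coord e e' = 0 := by
  classical
  have := (h.basis hu).repr_self_apply e' e
  rwa [if_neg hne, basis_apply] at this

theorem sum_coord_smul (h : IsSimplicialPair A B) {u : Module.Dual ℚ V} (hu : u ∈ B) (x : V) :
    ∑ e, (h.basis hu).coord e x • (e : V) = x := by
  simpa using (h.basis hu).sum_repr x

theorem sum_coord (h : IsSimplicialPair A B) {u : Module.Dual ℚ V} (hu : u ∈ B) (x : V) :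
    ∑ e, (h.basis hu).coord e x = -u x := by
  conv_rhs => rw [← h.sum_coord_smul hu x]
  rw [map_sum, ← Finset.sum_neg_distrib]
  apply Finset.sum_congr rfl
  intro e _
  rw [map_smul, (mem_tight.1 e.2).2, smul_eq_mul]
  ring

theorem card_tight (h : IsSimplicialPair A B) {u : Module.Dual ℚ V} (hu : u ∈ B) :
    (tight A u).card = Module.finrank ℚ V := by
  rw [Module.finrank_eq_card_basis (h.basis hu), Fintype.card_coe]

/-- Crossing the ridge of `F_u` opposite to the vertex `e` leads to a facet with exactly one new
vertex. The dual vertex of the neighbouring facet is the last point of `P^*` on the ray that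
starts at `u` in the direction of the coordinate function of `e`. -/
theorem exists_neighbour [DecidableEq V] (h : IsSimplicialPair A B) {u : Module.Dual ℚ V}
    (hu : u ∈ B) (e : tight A u) :
    ∃ γ : ℚ, 0 < γ ∧ u + γ • (h.basis hu).coord e ∈ B ∧
      ∃ v ∈ A, v ∉ tight A u ∧ (h.basis hu).coord e v < 0 ∧
        tight A (u + γ • (h.basis hu).coord e) = insert v ((tight A u).erase e) := by
  set c := (h.basis hu).coord e with hc
  have hc0 : c ≠ 0 := by
    intro h0
    have := h.coord_self hu e
    rw [← hc, h0] at this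
    norm_num at this
  have hcnn : ∀ v ∈ tight A u, 0 ≤ c v := by
    intro v hv
    by_cases hve : (⟨v, hv⟩ : tight A u) = e
    · have := h.coord_self hu e
      rw [← hve] at this
      rw [hc, ← hve, this]
      norm_num
    · exact (h.coord_of_ne hu hve).ge
  obtain ⟨v₀, hv₀, hv₀'⟩ := h.exists_neg c hc0
  obtain ⟨v, hv, hmin⟩ := Finset.exists_min_image (A.filter fun v => c v < 0)
    (fun v => (1 + u v) / (-c v)) ⟨v₀, Finset.mem_filter.2 ⟨hv₀, hv₀'⟩⟩
  obtain ⟨hvA, hcv⟩ := Finset.mem_filter.1 hv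
  have hvt : v ∉ tight A u := fun hvt => (hcnn v hvt).not_gt hcv
  have huv : 0 < 1 + u v := by
    have h1 := h.neg_one_le u hu v hvA
    have h2 : u v ≠ -1 := fun h2 => hvt (mem_tight.2 ⟨hvA, h2⟩)
    have := lt_of_le_of_ne h1 h2.symm
    linarith
  set γ := (1 + u v) / (-c v) with hγ
  have hγ0 : 0 < γ := div_pos huv (by linarith)
  set w := u + γ • c with hw
  have hwapp : ∀ x, w x = u x + γ * c x := fun x => by simp [hw]
  have hw1 : ∀ x ∈ A, -1 ≤ w x := by
    intro x hx
    rw [hwapp]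
    have h1 := h.neg_one_le u hu x hx
    rcases le_or_gt 0 (c x) with h0 | h0
    · have := mul_nonneg hγ0.le h0
      linarith
    · have h2 := hmin x (Finset.mem_filter.2 ⟨hx, h0⟩)
      have h3 : γ * (-c x) ≤ 1 + u x := (le_div_iff₀ (by linarith)).1 h2
      linarith
  have hwv : w v = -1 := by
    rw [hwapp, hγ]
    have : c v ≠ 0 := hcv.ne
    field_simp
    ring
  have hsub : insert v ((tight A u).erase e) ⊆ tight A w := by
    intro x hx
    rw [Finset.mem_insert, Finset.mem_erase] at hx
    rcases hx with rfl | ⟨hxe, hx⟩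
    · exact mem_tight.2 ⟨hvA, hwv⟩
    · refine mem_tight.2 ⟨(mem_tight.1 hx).1, ?_⟩
      have : c x = 0 := h.coord_of_ne hu (e' := ⟨x, hx⟩) (fun h => hxe (congrArg Subtype.val h))
      rw [hwapp, this, (mem_tight.1 hx).2]
      ring
  have hspan : Submodule.span ℚ (tight A w : Set V) = ⊤ := by
    have hother : ∀ x ∈ tight A u, x ≠ e → x ∈ Submodule.span ℚ (tight A w : Set V) := by
      intro x hx hxe
      apply Submodule.subset_span
      exact hsub (Finset.mem_insert_of_mem (Finset.mem_erase.2 ⟨hxe, hx⟩))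
    have he : (e : V) ∈ Submodule.span ℚ (tight A w : Set V) := by
      have h1 := h.sum_coord_smul hu v
      rw [← Finset.add_sum_erase _ _ (Finset.mem_univ e), ← hc] at h1
      have h2 : (e : V) = (c v)⁻¹ •
          (v - ∑ x ∈ Finset.univ.erase e, (h.basis hu).coord x v • (x : V)) := by
        rw [eq_inv_smul_iff₀ hcv.ne]
        exact eq_sub_of_add_eq h1
      rw [h2]
      apply Submodule.smul_mem
      apply Submodule.sub_mem
      · exact Submodule.subset_span (hsub (Finset.mem_insert_self _ _))
      · apply Submodule.sum_mem
        intro x hx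
        apply Submodule.smul_mem
        exact hother x x.2 (fun h => (Finset.mem_erase.1 hx).1 (Subtype.ext h))
    rw [eq_top_iff, ← h.span_tight u hu, Submodule.span_le]
    intro x hx
    by_cases hxe : x = e
    · rw [hxe]; exact he
    · exact hother x hx hxe
  have hwB : w ∈ B := h.mem_of_span w hw1 hspan
  refine ⟨γ, hγ0, hwB, v, hvA, hvt, hcv, ?_⟩
  symm
  apply Finset.eq_of_subset_of_card_le hsub
  rw [h.card_tight hwB, Finset.card_insert_of_notMem (fun h => hvt (Finset.mem_of_mem_erase h)),
    Finset.card_erase_of_mem e.2, h.card_tight hu]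
  omega

/-! ### Bounds on the number of vertices -/

/-- A vertex of level `0` with a negative coordinate at `e` lies on the neighbouring facet
across the ridge opposite to `e`, so it is the new vertex there. -/
theorem eq_of_coord_neg (h : IsSimplicialPair A B) {u : Module.Dual ℚ V} (hu : u ∈ B)
    (e : tight A u) {v w : V} (hv : v ∈ A) (hw : w ∈ A) (hv0 : u v = 0) (hw0 : u w = 0)
    (hve : (h.basis hu).coord e v < 0) (hwe : (h.basis hu).coord e w < 0) : v = w := by
  classical
  obtain ⟨γ, hγ, hB, x, -, -, -, ht⟩ := h.exists_neighbour hu e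
  have key : ∀ y ∈ A, u y = 0 → (h.basis hu).coord e y < 0 → y = x := by
    intro y hy hy0 hye
    have hval : (u + γ • (h.basis hu).coord e) y = -1 := by
      obtain ⟨k, hk⟩ := h.integral _ hB y hy
      have h1 := h.neg_one_le _ hB y hy
      have h2 : (u + γ • (h.basis hu).coord e) y < 0 := by
        rw [LinearMap.add_apply, LinearMap.smul_apply, hy0, zero_add, smul_eq_mul]
        exact mul_neg_of_pos_of_neg hγ hye
      rw [hk] at h1 h2 ⊢
      have h3 : k < 0 := by exact_mod_cast h2
      have h4 : -1 ≤ k := by exact_mod_cast h1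
      have : k = -1 := by omega
      rw [this]
      norm_num
    have hmem := mem_tight.2 ⟨hy, hval⟩
    rw [ht, Finset.mem_insert, Finset.mem_erase] at hmem
    rcases hmem with hmem | ⟨-, hmem⟩
    · exact hmem
    · have := (mem_tight.1 hmem).2
      rw [hy0] at this
      norm_num at this
  rw [key v hv hv0 hve, key w hw hw0 hwe]

/-- The origin is a positive combination of all dual vertices, so a vector that is nonnegative on all
of them, here the sum of the vertices, vanishes on all of them. -/
theorem sum_apply_vertices_eq_zero (h : IsSimplicialPair A B)
    (hnn : ∀ u ∈ B, 0 ≤ ∑ v ∈ A, u v) : ∀ u ∈ B, ∑ v ∈ A, u v = 0 := by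
  obtain ⟨m, hm, hm0⟩ := h.balance
  have hsum : ∑ u ∈ B, m u * ∑ v ∈ A, u v = 0 := by
    have := congrArg (fun f : Module.Dual ℚ V => f (∑ v ∈ A, v)) hm0
    simp only [Finset.mul_sum]
    rw [Finset.sum_comm]
    simpa only [LinearMap.sum_apply, LinearMap.smul_apply, map_sum, smul_eq_mul,
      LinearMap.zero_apply, Finset.sum_const_zero] using this
  intro u hu
  have h1 := (Finset.sum_eq_zero_iff_of_nonneg
    (fun u hu => mul_nonneg (hm u hu).le (hnn u hu))).1 hsum u hu
  rcases mul_eq_zero.1 h1 with h2 | h2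
  · exact absurd h2 (hm u hu).ne'
  · exact h2

/-- The dual vertices have the origin in their convex hull, so the sum of all vertices is
nonpositive at one of them. -/
theorem exists_sum_apply_vertices_nonpos (h : IsSimplicialPair A B) :
    ∃ u ∈ B, ∑ v ∈ A, u v ≤ 0 := by
  by_contra hcon
  push Not at hcon
  obtain ⟨u, hu⟩ := h.nonempty
  exact (hcon u hu).ne' (h.sum_apply_vertices_eq_zero (fun u hu => (hcon u hu).le) u hu)

/-- A nonzero vector of level `0` has coordinates of sum zero, so one of them is negative. -/
theorem exists_coord_neg (h : IsSimplicialPair A B) {u : Module.Dual ℚ V} (hu : u ∈ B) {v : V}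
    (hv : v ∈ levelZero A u) : ∃ e, (h.basis hu).coord e v < 0 := by
  obtain ⟨hvA, hv0⟩ := mem_levelZero.1 hv
  by_contra hcon
  push Not at hcon
  have hsum := h.sum_coord hu v
  rw [hv0, neg_zero, Finset.sum_eq_zero_iff_of_nonneg fun e _ => hcon e] at hsum
  have : v = 0 := by
    rw [← h.sum_coord_smul hu v]
    exact Finset.sum_eq_zero fun e he => by rw [hsum e he, zero_smul]
  exact h.zero_notMem (this ▸ hvA)

/-- Each vertex of level `0` is the new vertex of one of the `n` neighbouring facets. -/
theorem card_levelZero_le (h : IsSimplicialPair A B) {u : Module.Dual ℚ V} (hu : u ∈ B) :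
    (levelZero A u).card ≤ Module.finrank ℚ V := by
  have hex : ∀ v : levelZero A u, ∃ e, (h.basis hu).coord e v < 0 := fun v =>
    h.exists_coord_neg hu v.2
  choose f hf using hex
  have hinj : Function.Injective f := by
    intro v w hvw
    obtain ⟨hv, hv0⟩ := mem_levelZero.1 v.2
    obtain ⟨hw, hw0⟩ := mem_levelZero.1 w.2
    exact Subtype.ext (h.eq_of_coord_neg hu (f v) hv hw hv0 hw0 (hf v) (hvw ▸ hf w))
  have := Fintype.card_le_of_injective f hinj
  rwa [Fintype.card_coe, Fintype.card_coe, h.card_tight hu] at this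

/-- The integers `u v ≥ -1` are at least `1 - 2 [u v = -1] - [u v = 0]`. -/
theorem level_excess_nonneg (h : IsSimplicialPair A B) {u : Module.Dual ℚ V} (hu : u ∈ B)
    {v : V} (hv : v ∈ A) :
    0 ≤ u v - 1 + 2 * (if u v = -1 then 1 else 0) + (if u v = 0 then 1 else 0) := by
  obtain ⟨k, hk⟩ := h.integral u hu v hv
  have h1 := h.neg_one_le u hu v hv
  rw [hk] at h1 ⊢
  have h2 : -1 ≤ k := by exact_mod_cast h1
  rcases eq_or_lt_of_le h2 with rfl | h3
  · norm_num
  · rcases eq_or_lt_of_le (show 0 ≤ k by omega) with rfl | h4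
    · norm_num
    · have h5 : (1 : ℚ) ≤ k := by exact_mod_cast h4
      have : (k : ℚ) ≠ -1 := by linarith
      have : (k : ℚ) ≠ 0 := by linarith
      simp [*]

theorem sum_level_excess (h : IsSimplicialPair A B) {u : Module.Dual ℚ V} (hu : u ∈ B) :
    ∑ v ∈ A, (u v - 1 + 2 * (if u v = -1 then 1 else 0) + (if u v = 0 then 1 else 0)) =
      ∑ v ∈ A, u v - A.card + 2 * (Module.finrank ℚ V) + (levelZero A u).card := by
  rw [Finset.sum_add_distrib, Finset.sum_add_distrib, Finset.sum_sub_distrib, ← Finset.mul_sum,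
    Finset.sum_boole, Finset.sum_boole, ← h.card_tight hu]
  simp [tight, levelZero]

theorem card_le_three_mul (h : IsSimplicialPair A B) : A.card ≤ 3 * Module.finrank ℚ V := by
  obtain ⟨u, hu, hsum⟩ := h.exists_sum_apply_vertices_nonpos
  have h1 := Finset.sum_nonneg fun v hv => h.level_excess_nonneg hu hv
  rw [h.sum_level_excess hu] at h1
  have h2 := h.card_levelZero_le hu
  have h3 : ((levelZero A u).card : ℚ) ≤ Module.finrank ℚ V := by exact_mod_cast h2
  have h4 : (A.card : ℚ) ≤ 3 * Module.finrank ℚ V := by linarith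
  exact_mod_cast h4

/-- With the maximal number of vertices, every facet sees `n` vertices at level `0`, and all other
vertices not on it at level `1`. -/
theorem levels_of_card_eq_three_mul (h : IsSimplicialPair A B)
    (hcard : A.card = 3 * Module.finrank ℚ V) {u : Module.Dual ℚ V} (hu : u ∈ B) :
    (levelZero A u).card = Module.finrank ℚ V ∧
      ∀ v ∈ A, u v = -1 ∨ u v = 0 ∨ u v = 1 := by
  have hcard' : (A.card : ℚ) = 3 * Module.finrank ℚ V := by exact_mod_cast hcard
  have hz : ∀ u ∈ B, ((levelZero A u).card : ℚ) ≤ Module.finrank ℚ V := fun u hu => by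
    exact_mod_cast h.card_levelZero_le hu
  have hnn : ∀ u ∈ B, 0 ≤ ∑ v ∈ A, u v := by
    intro u hu
    have h1 := Finset.sum_nonneg fun v hv => h.level_excess_nonneg hu hv
    rw [h.sum_level_excess hu] at h1
    linarith [hz u hu]
  have h0 := h.sum_apply_vertices_eq_zero hnn u hu
  have h1 := Finset.sum_nonneg fun v hv => h.level_excess_nonneg hu hv
  have h2 := h.sum_level_excess hu
  have h3 := hz u hu
  have h4 : ((levelZero A u).card : ℚ) = Module.finrank ℚ V := by linarith
  refine ⟨by exact_mod_cast h4, ?_⟩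
  have h5 : ∑ v ∈ A, (u v - 1 + 2 * (if u v = -1 then 1 else 0) + (if u v = 0 then 1 else 0)) = 0 :=
    by linarith
  intro v hv
  have h6 := (Finset.sum_eq_zero_iff_of_nonneg
    fun v hv => h.level_excess_nonneg hu hv).1 h5 v hv
  by_cases ha : u v = -1
  · exact Or.inl ha
  · by_cases hb : u v = 0
    · exact Or.inr (Or.inl hb)
    · rw [if_neg ha, if_neg hb] at h6
      right; right; linarith

/-- The sum over all vertices of the excess of `u v` over the value `d - (d + 1) [u v = -1]`, which
is nonnegative if `u v ≥ d` holds away from the facet of `u`. -/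
theorem sum_delta_excess (h : IsSimplicialPair A B) {u : Module.Dual ℚ V} (hu : u ∈ B) (d : ℚ) :
    ∑ v ∈ A, (u v - d + (d + 1) * (if u v = -1 then 1 else 0)) =
      ∑ v ∈ A, u v - d * A.card + (d + 1) * (Module.finrank ℚ V) := by
  rw [Finset.sum_add_distrib, Finset.sum_sub_distrib, ← Finset.mul_sum,
    Finset.sum_boole, ← h.card_tight hu]
  simp [tight, mul_comm]

theorem delta_excess_nonneg {d : ℚ} {u : Module.Dual ℚ V}
    (hd : ∀ v ∈ A, u v ≠ -1 → d ≤ u v) {v : V} (hv : v ∈ A) :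
    0 ≤ u v - d + (d + 1) * (if u v = -1 then 1 else 0) := by
  by_cases hv1 : u v = -1
  · rw [if_pos hv1, hv1]
    linarith
  · rw [if_neg hv1]
    linarith [hd v hv hv1]

theorem mul_card_le (h : IsSimplicialPair A B) {d : ℚ}
    (hd : ∀ u ∈ B, ∀ v ∈ A, u v ≠ -1 → d ≤ u v) :
    d * A.card ≤ (d + 1) * Module.finrank ℚ V := by
  obtain ⟨u, hu, hsum⟩ := h.exists_sum_apply_vertices_nonpos
  have h1 := Finset.sum_nonneg fun v hv => delta_excess_nonneg (hd u hu) hv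
  rw [h.sum_delta_excess hu] at h1
  linarith

theorem eq_delta_of_mul_card_eq (h : IsSimplicialPair A B) {d : ℚ}
    (hd : ∀ u ∈ B, ∀ v ∈ A, u v ≠ -1 → d ≤ u v)
    (hcard : d * A.card = (d + 1) * Module.finrank ℚ V) {u : Module.Dual ℚ V} (hu : u ∈ B)
    {v : V} (hv : v ∈ A) (hv1 : u v ≠ -1) : u v = d := by
  have hnn : ∀ u ∈ B, 0 ≤ ∑ v ∈ A, u v := by
    intro u hu
    have h1 := Finset.sum_nonneg fun v hv => delta_excess_nonneg (hd u hu) hv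
    rw [h.sum_delta_excess hu] at h1
    linarith
  have h0 := h.sum_apply_vertices_eq_zero hnn u hu
  have h1 := h.sum_delta_excess hu d
  have h2 : ∑ v ∈ A, (u v - d + (d + 1) * (if u v = -1 then 1 else 0)) = 0 := by linarith
  have h3 := (Finset.sum_eq_zero_iff_of_nonneg
    fun v hv => delta_excess_nonneg (hd u hu) hv).1 h2 v hv
  rw [if_neg hv1] at h3
  linarith

end IsSimplicialPair

end Neighbour

section Simplices

variable {V : Type*} [AddCommGroup V] [Module ℚ V]

/-! ### Simplices with vertices of sum zero -/

theorem vertices_convexHull_range {ι : Type*} {p : ι → V} (hp : AffineIndependent ℚ p) :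
    vertices (convexHull ℚ (Set.range p)) = Set.range p := by
  apply Set.Subset.antisymm extremePoints_convexHull_subset
  rintro _ ⟨i, rfl⟩
  by_contra hi
  have h1 := mem_convexHull_diff_of_notMem_extremePoints (Set.mem_range_self i) hi
  have h2 : Set.range p \ {p i} = p '' (Set.univ \ {i}) := by
    rw [Set.image_sdiff hp.injective, Set.image_singleton, Set.image_univ]
  rw [h2] at h1
  exact hp.notMem_affineSpan_sdiff i Set.univ (convexHull_subset_affineSpan _ h1)

theorem finsum_vertices_convexHull_range {ι : Type*} [Fintype ι] {p : ι → V}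
    (hp : AffineIndependent ℚ p) :
    ∑ᶠ v ∈ vertices (convexHull ℚ (Set.range p)), v = ∑ i, p i := by
  rw [vertices_convexHull_range hp, finsum_mem_range hp.injective, finsum_eq_sum_of_fintype]

theorem affineIndependent_cons_neg_sum {d : ℕ} {e : Fin d → V} (he : LinearIndependent ℚ e) :
    AffineIndependent ℚ (Fin.cons (-∑ i, e i) e : Fin (d + 1) → V) := by
  rw [affineIndependent_iff]
  intro s w hw hws i hi
  classical
  -- pass to weights on the whole index set
  set w' : Fin (d + 1) → ℚ := fun i => if i ∈ s then w i else 0 with hw'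
  have h1 : ∑ i, w' i = 0 := by
    rw [← hw, hw', Finset.sum_ite_mem, Finset.univ_inter]
  have h2 : ∑ i, w' i • (Fin.cons (-∑ i, e i) e : Fin (d + 1) → V) i = 0 := by
    rw [← hws, hw']
    simp only [ite_smul, zero_smul]
    rw [Finset.sum_ite_mem, Finset.univ_inter]
  rw [Fin.sum_univ_succ] at h1 h2
  simp only [Fin.cons_zero, Fin.cons_succ] at h2
  have h3 : ∑ i : Fin d, (w' i.succ - w' 0) • e i = 0 := by
    rw [← h2, smul_neg, Finset.smul_sum, ← sub_eq_neg_add, ← Finset.sum_sub_distrib]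
    exact Finset.sum_congr rfl fun i _ => sub_smul _ _ _
  have h4 : ∀ i : Fin d, w' i.succ = w' 0 := fun i =>
    sub_eq_zero.1 (Fintype.linearIndependent_iff.1 he _ h3 i)
  simp only [h4, Finset.sum_const, Finset.card_univ, Fintype.card_fin, nsmul_eq_mul] at h1
  have h5 : w' 0 = 0 := by
    have : ((d : ℚ) + 1) * w' 0 = 0 := by linarith
    rcases mul_eq_zero.1 this with h | h
    · have : (0 : ℚ) ≤ d := Nat.cast_nonneg d
      linarith
    · exact h
  have h6 : ∀ i, w' i = 0 := by
    intro i
    refine Fin.cases h5 (fun i => ?_) i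
    rw [h4, h5]
  have := h6 i
  simpa only [hw', if_pos hi] using this

/-- Linearly independent vectors together with the negative of their sum are the vertices of a
simplex. -/
theorem isSimplex_insert_neg_sum {J : Finset V} (hJ : LinearIndepOn ℚ id (J : Set V)) :
    IsSimplex J.card (convexHull ℚ (insert (-∑ v ∈ J, v) (J : Set V))) ∧
      ∑ᶠ v ∈ vertices (convexHull ℚ (insert (-∑ v ∈ J, v) (J : Set V))), v = 0 := by
  set e : Fin J.card → V := fun i => (J.equivFin.symm i : V) with he
  have hlin : LinearIndependent ℚ e :=
    LinearIndependent.comp hJ J.equivFin.symm J.equivFin.symm.injective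
  have hsum : ∑ i, e i = ∑ v ∈ J, v := by
    rw [he, Equiv.sum_comp J.equivFin.symm (fun x : J => (x : V)), Finset.sum_coe_sort J fun x => x]
  have hrange : Set.range e = J := by
    ext v
    constructor
    · rintro ⟨i, rfl⟩
      exact (J.equivFin.symm i).2
    · intro hv
      exact ⟨J.equivFin ⟨v, hv⟩, by simp [he]⟩
  have haff := affineIndependent_cons_neg_sum hlin
  have hr : Set.range (Fin.cons (-∑ i, e i) e : Fin (J.card + 1) → V) =
      insert (-∑ v ∈ J, v) (J : Set V) := by
    rw [Fin.range_cons, hrange, hsum]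
  refine ⟨⟨_, haff, by rw [hr]⟩, ?_⟩
  rw [← hr, finsum_vertices_convexHull_range haff, Fin.sum_univ_succ]
  simp

theorem zero_mem_convexHull_of_sum_eq_zero {ι : Type*} [Fintype ι] [Nonempty ι] {p : ι → V}
    (h : ∑ i, p i = 0) : (0 : V) ∈ convexHull ℚ (Set.range p) := by
  have hc : (Fintype.card ι : ℚ) ≠ 0 := by
    exact_mod_cast Fintype.card_ne_zero
  have h1 : ∑ i, (Fintype.card ι : ℚ)⁻¹ • p i ∈ convexHull ℚ (Set.range p) := by
    apply (convex_convexHull ℚ _).sum_mem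
    · intro i _
      positivity
    · rw [Finset.sum_const, Finset.card_univ, nsmul_eq_mul, mul_inv_cancel₀ hc]
    · intro i _
      exact subset_convexHull ℚ _ ⟨i, rfl⟩
  rwa [← Finset.smul_sum, h, smul_zero] at h1

/-! ### Sections of a reflexive polytope that are also projections -/

/-- If a projection onto the span of `Q` maps the reflexive polytope `P` into its subset `Q`, then
`Q` is reflexive: functionals on the span extend along the projection, so that the dual of `Q` is
the image of the dual of `P` under restriction. -/
theorem isReflexiveInSpan_of_projection {L : Submodule ℤ V} {P Q : Set V} (hP : IsReflexive L P)
    (hQ : IsLatticePolytope L Q) (hQP : Q ⊆ P) (π : V →ₗ[ℚ] V)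
    (hπ : ∀ x ∈ Q, π x = x) (hπP : ∀ x ∈ P, π x ∈ Q) : IsReflexiveInSpan L Q := by
  classical
  have hspan : ∀ x, π x ∈ Submodule.span ℚ Q := by
    intro x
    obtain ⟨ε, hε, hx⟩ := hP.zeroInInterior x
    have h1 := Submodule.smul_mem _ ε⁻¹ (Submodule.subset_span (R := ℚ) (hπP _ (hx ε hε.le le_rfl)))
    rwa [map_smul, smul_smul, inv_mul_cancel₀ hε.ne', one_smul] at h1
  have hid : ∀ x ∈ Submodule.span ℚ Q, π x = x := by
    intro x hx
    have : Set.EqOn π LinearMap.id (Submodule.span ℚ Q) := LinearMap.eqOn_span hπ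
    exact this hx
  set π' : V →ₗ[ℚ] Submodule.span ℚ Q := π.codRestrict _ hspan with hπ'
  obtain ⟨S, hSL, hS⟩ := hQ
  refine ⟨⟨S.preimage (Subtype.val : Submodule.span ℚ Q → V) Subtype.val_injective.injOn, ?_, ?_⟩,
    ?_, ?_⟩
  · intro x hx
    rw [Finset.coe_preimage] at hx
    exact hSL hx
  · apply Subtype.val_injective.image_injective
    have h1 : Subtype.val '' (convexHull ℚ ((S.preimage (Subtype.val : Submodule.span ℚ Q → V)
        Subtype.val_injective.injOn : Finset _) : Set (Submodule.span ℚ Q))) =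
        convexHull ℚ (Subtype.val '' ((S.preimage (Subtype.val : Submodule.span ℚ Q → V)
        Subtype.val_injective.injOn : Finset _) : Set (Submodule.span ℚ Q))) :=
      (Submodule.span ℚ Q).subtype.image_convexHull _
    have h4 : ∀ s : Set V, Subtype.val '' ((↑) ⁻¹' s : Set (Submodule.span ℚ Q)) =
        (Submodule.span ℚ Q : Set V) ∩ s := fun s => Subtype.image_preimage_coe _ s
    rw [h1, Finset.coe_preimage, h4, h4]
    have h2 : Q ⊆ Submodule.span ℚ Q := Submodule.subset_span
    have h3 : (S : Set V) ⊆ Submodule.span ℚ Q := by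
      refine Set.Subset.trans ?_ h2
      conv_rhs => rw [hS]
      exact subset_convexHull ℚ _
    rw [Set.inter_eq_self_of_subset_right, Set.inter_eq_self_of_subset_right]
    · exact hS
    · exact h3
    · exact h2
  · intro x
    obtain ⟨ε, hε, hx⟩ := hP.zeroInInterior (x : V)
    refine ⟨ε, hε, fun t ht0 ht => ?_⟩
    have h1 := hπP _ (hx t ht0 ht)
    rw [map_smul, hid _ x.2] at h1
    exact h1
  · obtain ⟨T, hTL, hT⟩ := hP.isLatticePolytope_dual
    set ρ : Module.Dual ℚ V →ₗ[ℚ] Module.Dual ℚ (Submodule.span ℚ Q) :=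
      (Submodule.span ℚ Q).subtype.dualMap with hρ
    refine ⟨T.image ρ, ?_, ?_⟩
    · rw [Finset.coe_image]
      rintro _ ⟨u, hu, rfl⟩ x hx
      exact hTL hu x hx
    · rw [Finset.coe_image, ← ρ.image_convexHull, ← hT]
      ext y
      constructor
      · intro hy
        refine ⟨y.comp π', ?_, ?_⟩
        · intro x hx
          exact hy (π' x) (hπP x hx)
        · ext x
          change y (π' x) = y x
          congr 1
          exact Subtype.ext (hid x x.2)
      · rintro ⟨u, hu, rfl⟩ x hx
        exact hu x (hQP hx)

/-- A partition of a basis decomposes the space into the spans of the parts. -/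
theorem isInternal_span_fiber {ι κ : Type*} [DecidableEq κ] (b : Module.Basis ι ℚ V) (f : ι → κ) :
    DirectSum.IsInternal fun j => Submodule.span ℚ (b '' {i | f i = j}) := by
  apply DirectSum.isInternal_submodule_of_iSupIndep_of_iSup_eq_top
  · intro j
    have h1 : (⨆ k, ⨆ (_ : k ≠ j), Submodule.span ℚ (b '' {i | f i = k})) ≤
        Submodule.span ℚ (b '' {i | f i ≠ j}) := by
      apply iSup₂_le
      rintro k hk
      apply Submodule.span_mono
      apply Set.image_mono
      rintro i rfl
      exact hk
    refine Disjoint.mono_right h1 ?_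
    apply b.linearIndependent.disjoint_span_image
    rw [Set.disjoint_left]
    intro i hi hi'
    exact hi' hi
  · rw [eq_top_iff, ← b.span_eq, Submodule.span_le]
    rintro _ ⟨i, rfl⟩
    exact Submodule.mem_iSup_of_mem (f i) (Submodule.subset_span ⟨i, rfl, rfl⟩)

end Simplices

section Splitting

variable {V : Type*} [AddCommGroup V] [Module ℚ V]
variable {A : Finset V} {B : Finset (Module.Dual ℚ V)}

/-! ### Decomposition into simplices when only two levels occur -/

/-- If the dual vertices take only the values `-1` and `d` on the vertices, then the vertices
outside a facet have all coordinates `0` or `-1` in the basis of that facet, and every coordinate is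
nonzero on exactly one of them. -/
theorem IsSimplicialPair.exists_coord_eq_ite [DecidableEq V] (h : IsSimplicialPair A B) {d : ℚ}
    (hd : 0 < d) (hval : ∀ u ∈ B, ∀ v ∈ A, u v ≠ -1 → u v = d) {u : Module.Dual ℚ V}
    (hu : u ∈ B) :
    ∃ κ : tight A u → V, (∀ e, κ e ∈ A \ tight A u) ∧
      ∀ f ∈ A \ tight A u, ∀ e, (h.basis hu).coord e f = if κ e = f then -1 else 0 := by
  have hex : ∀ e : tight A u, ∃ v ∈ A \ tight A u, ∀ f ∈ A \ tight A u,
      (h.basis hu).coord e f = if v = f then -1 else 0 := by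
    intro e
    obtain ⟨γ, hγ, hB, v, hv, hvt, hcv, ht⟩ := h.exists_neighbour hu e
    have happ : ∀ x, (u + γ • (h.basis hu).coord e) x = u x + γ * (h.basis hu).coord e x :=
      fun x => by simp
    -- evaluate the neighbouring dual vertex at `e`
    have hγd : γ = d + 1 := by
      have h1 : (u + γ • (h.basis hu).coord e) e = -1 + γ := by
        rw [happ, h.coord_self, (mem_tight.1 e.2).2, mul_one]
      have h2 := hval _ hB e (mem_tight.1 e.2).1 (by rw [h1]; linarith)
      linarith
    have hlevel : ∀ f ∈ A \ tight A u, u f = d := by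
      intro f hf
      rw [Finset.mem_sdiff] at hf
      exact hval u hu f hf.1 fun h => hf.2 (mem_tight.2 ⟨hf.1, h⟩)
    refine ⟨v, Finset.mem_sdiff.2 ⟨hv, hvt⟩, ?_⟩
    intro f hf
    have hfA := (Finset.mem_sdiff.1 hf).1
    have hft := (Finset.mem_sdiff.1 hf).2
    have hmem : f ∈ tight A (u + γ • (h.basis hu).coord e) ↔ v = f := by
      rw [ht, Finset.mem_insert]
      constructor
      · rintro (hh | hh)
        · exact hh.symm
        · exact absurd (Finset.mem_of_mem_erase hh) hft
      · exact fun hh => Or.inl hh.symm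
    have hd1 : d + 1 ≠ 0 := by linarith
    split_ifs with hvf
    · have h1 := (mem_tight.1 (hmem.2 hvf)).2
      rw [happ, hlevel f hf, hγd] at h1
      have : (d + 1) * ((h.basis hu).coord e f + 1) = 0 := by linarith
      rcases mul_eq_zero.1 this with hh | hh
      · exact absurd hh hd1
      · linarith
    · have h1 := hval _ hB f hfA fun hh => hvf (hmem.1 (mem_tight.2 ⟨hfA, hh⟩))
      rw [happ, hlevel f hf, hγd] at h1
      have : (d + 1) * (h.basis hu).coord e f = 0 := by linarith
      rcases mul_eq_zero.1 this with hh | hh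
      · exact absurd hh hd1
      · exact hh
  choose κ hκ1 hκ2 using hex
  exact ⟨κ, hκ1, fun f hf e => hκ2 e f hf⟩

/-- If the dual vertices take only the values `-1` and `d` on the vertices, then `P` is the free sum
of reflexive simplices of dimension `d`: each vertex outside a fixed facet is the negative of a sum
of vertices of the facet, and these sums involve disjoint sets of `d` vertices. -/
theorem exists_simplices {L : Submodule ℤ V} {P : Set V} (hP : IsReflexive L P)
    (h : IsSimplicialPair A B) (hPA : P = convexHull ℚ (A : Set V)) (hAL : (A : Set V) ⊆ L)
    {d : ℕ} (hd : 0 < d) (hval : ∀ u ∈ B, ∀ v ∈ A, u v ≠ -1 → u v = d)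
    (hcard : d * A.card = (d + 1) * Module.finrank ℚ V) :
    ∃ (r : ℕ) (Q : Fin r → Set V), d * r = Module.finrank ℚ V ∧ P = convexHull ℚ (⋃ j, Q j) ∧
      (∀ j, IsSimplex d (Q j) ∧ IsReflexiveInSpan L (Q j) ∧ ∑ᶠ v ∈ vertices (Q j), v = 0) ∧
      DirectSum.IsInternal fun j => Submodule.span ℚ (Q j) := by
  classical
  obtain ⟨u, hu⟩ := h.nonempty
  obtain ⟨κ, hκ, hcoord⟩ := h.exists_coord_eq_ite (by exact_mod_cast hd) hval hu
  set W := A \ tight A u with hW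
  set r := W.card with hr
  have htA : tight A u ⊆ A := Finset.filter_subset _ _
  have hcardA : A.card = Module.finrank ℚ V + r := by
    rw [hr, hW, Finset.card_sdiff_of_subset htA, h.card_tight hu]
    have := Finset.card_le_card htA
    rw [h.card_tight hu] at this
    omega
  set f : Fin r → V := fun j => (W.equivFin.symm j : V) with hf
  have hfW : ∀ j, f j ∈ W := fun j => (W.equivFin.symm j).2
  have hfinj : Function.Injective f := Subtype.val_injective.comp W.equivFin.symm.injective
  set k : tight A u → Fin r := fun e => W.equivFin ⟨κ e, hκ e⟩ with hk
  have hfk : ∀ e j, κ e = f j ↔ k e = j := by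
    intro e j
    rw [hk, hf, ← Equiv.eq_symm_apply, Subtype.ext_iff]
  set J : Fin r → Finset V := fun j => (Finset.univ.filter fun e => k e = j).image Subtype.val
    with hJ
  have hJsub : ∀ j, J j ⊆ tight A u := by
    intro j v hv
    obtain ⟨e, -, rfl⟩ := Finset.mem_image.1 hv
    exact e.2
  have hJsum : ∀ j, f j = -∑ v ∈ J j, v := by
    intro j
    rw [hJ, Finset.sum_image (fun x _ y _ hxy => Subtype.ext hxy), ← h.sum_coord_smul hu (f j),
      Finset.sum_filter, ← Finset.sum_neg_distrib]
    apply Finset.sum_congr rfl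
    intro e _
    rw [hcoord _ (hfW j)]
    simp only [hfk]
    split_ifs <;> simp
  have hJcard : ∀ j, (J j).card = d := by
    intro j
    have h1 : u (f j) = d := by
      have := Finset.mem_sdiff.1 (hfW j)
      exact hval u hu _ this.1 fun hh => this.2 (mem_tight.2 ⟨this.1, hh⟩)
    have h2 : u (f j) = (J j).card := by
      rw [hJsum j, map_neg, map_sum, Finset.sum_congr rfl fun v hv => (mem_tight.1 (hJsub j hv)).2]
      simp
    rw [h1] at h2
    exact_mod_cast h2.symm
  set S : Fin r → Set V := fun j => insert (f j) (J j : Set V) with hS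
  set Q : Fin r → Set V := fun j => convexHull ℚ (S j) with hQ
  have hSA : ∀ j, S j ⊆ A := by
    intro j
    exact Set.insert_subset (Finset.mem_sdiff.1 (hfW j)).1 fun v hv => htA (hJsub j hv)
  have hAS : ∀ v ∈ A, ∃ j, v ∈ S j := by
    intro v hv
    by_cases hvt : v ∈ tight A u
    · refine ⟨k ⟨v, hvt⟩, Set.mem_insert_of_mem _ ?_⟩
      exact Finset.mem_coe.2 (Finset.mem_image.2 ⟨⟨v, hvt⟩, by simp, rfl⟩)
    · refine ⟨W.equivFin ⟨v, Finset.mem_sdiff.2 ⟨hv, hvt⟩⟩, ?_⟩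
      apply Set.mem_insert_iff.2
      left
      simp [hf]
  have hQP : ∀ j, Q j ⊆ P := by
    intro j
    rw [hPA]
    exact convexHull_mono (hSA j)
  have hspan : ∀ j, Submodule.span ℚ (Q j) = Submodule.span ℚ (h.basis hu '' {e | k e = j}) := by
    intro j
    have hJim : (h.basis hu '' {e | k e = j}) = (J j : Set V) := by
      ext v
      simp [hJ]
    rw [hJim]
    apply le_antisymm
    · rw [Submodule.span_le]
      refine convexHull_min ?_ (Submodule.convex _)
      refine Set.insert_subset ?_ Submodule.subset_span
      rw [hJsum j]
      exact Submodule.neg_mem _ (Submodule.sum_mem _ fun v hv => Submodule.subset_span hv)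
    · apply Submodule.span_mono
      exact (Set.subset_insert _ _).trans (subset_convexHull ℚ _)
  have hsimplex : ∀ j, IsSimplex d (Q j) ∧ ∑ᶠ v ∈ vertices (Q j), v = 0 := by
    intro j
    have h1 := isSimplex_insert_neg_sum ((h.linearIndepOn u hu).mono
      (show (J j : Set V) ⊆ tight A u from hJsub j))
    rwa [hJcard j, ← hJsum j] at h1
  have hzero : ∀ j, (0 : V) ∈ Q j := by
    intro j
    obtain ⟨⟨p, hp, hQp⟩, hsum⟩ := hsimplex j
    rw [hQp] at hsum ⊢
    rw [finsum_vertices_convexHull_range hp] at hsum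
    exact zero_mem_convexHull_of_sum_eq_zero hsum
  refine ⟨r, Q, ?_, ?_, ?_, ?_⟩
  · rw [hcardA, Nat.mul_add, Nat.add_mul] at hcard
    omega
  · apply Set.Subset.antisymm
    · rw [hPA]
      apply convexHull_mono
      intro v hv
      obtain ⟨j, hj⟩ := hAS v hv
      exact Set.mem_iUnion.2 ⟨j, subset_convexHull ℚ _ hj⟩
    · apply convexHull_min (Set.iUnion_subset hQP)
      rw [hPA]
      exact convex_convexHull ℚ _
  · intro j
    refine ⟨(hsimplex j).1, ?_, (hsimplex j).2⟩
    -- the projection that forgets all basis vectors outside the part with index `j`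
    set π : V →ₗ[ℚ] V := (h.basis hu).constr ℚ fun e => if k e = j then (e : V) else 0 with hπ
    have hπe : ∀ e : tight A u, π e = if k e = j then (e : V) else 0 := by
      intro e
      have := (h.basis hu).constr_basis ℚ (fun e => if k e = j then (e : V) else 0) e
      rwa [h.basis_apply] at this
    have hπJ : ∀ i, ∀ v ∈ J i, π v = if i = j then v else 0 := by
      intro i v hv
      obtain ⟨e, he, rfl⟩ := Finset.mem_image.1 hv
      rw [hπe, (Finset.mem_filter.1 he).2]
    have hπf : ∀ i, π (f i) = if i = j then f i else 0 := by
      intro i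
      rw [hJsum i, map_neg, map_sum, Finset.sum_congr rfl (hπJ i)]
      split_ifs <;> simp
    have hπS : ∀ i, ∀ v ∈ S i, π v = if i = j then v else 0 := by
      rintro i v (rfl | hv)
      · exact hπf i
      · exact hπJ i v hv
    apply isReflexiveInSpan_of_projection hP _ (hQP j) π
    · intro x hx
      have h1 : Q j ⊆ LinearMap.ker (π - LinearMap.id) := by
        refine convexHull_min ?_ (Submodule.convex _)
        intro v hv
        simp [hπS j v hv]
      have := h1 hx
      simpa [sub_eq_zero] using this
    · intro x hx
      have h2 : P ⊆ π ⁻¹' Q j := by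
        rw [hPA]
        refine convexHull_min ?_ ((convex_convexHull ℚ _).linear_preimage π)
        intro v hv
        obtain ⟨i, hi⟩ := hAS v hv
        rw [Set.mem_preimage, hπS i v hi]
        split_ifs with hij
        · exact subset_convexHull ℚ _ (hij ▸ hi)
        · exact hzero j
      exact h2 hx
    · refine ⟨insert (f j) (J j), ?_, ?_⟩
      · rw [Finset.coe_insert]
        exact (hSA j).trans hAL
      · rw [Finset.coe_insert]
  · simp only [hspan]
    exact isInternal_span_fiber (h.basis hu) k

/-! ### The number of vertices of a free sum of simplices -/

/-- In a simplex with vertices of sum zero, any functional on the linear span is determined by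
arbitrary values of sum zero at the vertices. -/
theorem exists_dual_of_sum_eq_zero {d : ℕ} {p : Fin (d + 1) → V} (hp : AffineIndependent ℚ p)
    (hsum : ∑ i, p i = 0) (c : Fin (d + 1) → ℚ) (hc : ∑ i, c i = 0) :
    ∃ f : Module.Dual ℚ V, ∀ i, f (p i) = c i := by
  have hlin : LinearIndependent ℚ fun i : Fin d => p i.succ := by
    rw [Fintype.linearIndependent_iff]
    intro g hg
    set s : ℚ := (∑ i, g i) / (d + 1) with hs
    have hd : (d : ℚ) + 1 ≠ 0 := by positivity
    have h1 : ∑ i, ((Fin.cons 0 g : Fin (d + 1) → ℚ) i - s) = 0 := by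
      rw [Finset.sum_sub_distrib, Fin.sum_univ_succ]
      simp only [Fin.cons_zero, Fin.cons_succ, Finset.sum_const, Finset.card_univ,
        Fintype.card_fin, nsmul_eq_mul, hs]
      push_cast
      field_simp
      ring
    have h2 : ∑ i, ((Fin.cons 0 g : Fin (d + 1) → ℚ) i - s) • p i = 0 := by
      simp only [sub_smul]
      rw [Finset.sum_sub_distrib, ← Finset.smul_sum, hsum, smul_zero, sub_zero, Fin.sum_univ_succ]
      simpa using hg
    have h3 := hp.eq_zero_of_sum_eq_zero h1 h2
    have h4 := h3 0 (Finset.mem_univ _)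
    intro i
    have h5 := h3 i.succ (Finset.mem_univ _)
    simp only [Fin.cons_zero, Fin.cons_succ] at h4 h5
    linarith
  obtain ⟨f, hf⟩ : ∃ f : Module.Dual ℚ V, ∀ i : Fin d, f (p i.succ) = c i.succ := by
    obtain ⟨f, hf⟩ := ((Module.Basis.span hlin).constr ℚ fun i => c i.succ).exists_extend
    refine ⟨f, fun i => ?_⟩
    have h1 := LinearMap.congr_fun hf (Module.Basis.span hlin i)
    rw [Module.Basis.constr_basis] at h1
    rw [← h1, LinearMap.comp_apply, Submodule.subtype_apply, Module.Basis.span_apply]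
  refine ⟨f, fun i => Fin.cases ?_ hf i⟩
  rw [Fin.sum_univ_succ] at hsum hc
  rw [eq_neg_of_add_eq_zero_left hsum, eq_neg_of_add_eq_zero_left hc, map_neg, map_sum]
  simp [hf]

/-- In a free sum of `r` simplices of dimension `d`, all `r * (d + 1)` vertices of the simplices are
vertices: each of them is the unique maximizer of a functional that vanishes on the other
summands. -/
theorem le_ncard_vertices_of_simplices {P : Set V} {d r : ℕ} {Q : Fin r → Set V} (hd : 0 < d)
    (hfin : (vertices P).Finite) (hP : P = convexHull ℚ (⋃ j, Q j))
    (hQ : ∀ j, IsSimplex d (Q j) ∧ ∑ᶠ v ∈ vertices (Q j), v = 0)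
    (hint : DirectSum.IsInternal fun j => Submodule.span ℚ (Q j)) :
    r * (d + 1) ≤ (vertices P).ncard := by
  classical
  choose p hp hQp using fun j => (hQ j).1
  have hsum : ∀ j, ∑ i, p j i = 0 := by
    intro j
    have := (hQ j).2
    rwa [hQp j, finsum_vertices_convexHull_range (hp j)] at this
  set q : Fin r × Fin (d + 1) → V := fun x => p x.1 x.2 with hq
  have hPq : P = convexHull ℚ (Set.range q) := by
    rw [hP]
    apply Set.Subset.antisymm
    · refine convexHull_min (Set.iUnion_subset fun j => ?_) (convex_convexHull ℚ _)
      rw [hQp j]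
      apply convexHull_mono
      rintro _ ⟨i, rfl⟩
      exact ⟨(j, i), rfl⟩
    · apply convexHull_mono
      rintro _ ⟨⟨j, i⟩, rfl⟩
      refine Set.mem_iUnion.2 ⟨j, ?_⟩
      rw [hQp j]
      exact subset_convexHull ℚ _ ⟨i, rfl⟩
  have hmem : ∀ j i, p j i ∈ Submodule.span ℚ (Q j) := by
    intro j i
    apply Submodule.subset_span
    rw [hQp j]
    exact subset_convexHull ℚ _ ⟨i, rfl⟩
  have hd' : (0 : ℚ) < d := by exact_mod_cast hd
  have hsep : ∀ x, ∃ F : Module.Dual ℚ V, ∀ y, y ≠ x → F (q y) < F (q x) := by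
    rintro ⟨j, i⟩
    obtain ⟨f, hf⟩ := exists_dual_of_sum_eq_zero (hp j) (hsum j)
      (fun k => if k = i then 1 else -(1 / (d : ℚ))) (by
        rw [← Finset.add_sum_erase _ _ (Finset.mem_univ i), if_pos rfl,
          Finset.sum_congr rfl fun k hk => if_neg (Finset.ne_of_mem_erase hk),
          Finset.sum_const, Finset.card_erase_of_mem (Finset.mem_univ i)]
        simp only [Finset.card_univ, Fintype.card_fin, Nat.add_sub_cancel, nsmul_eq_mul]
        field_simp
        ring)
    have hcompl := hint.submodule_iSupIndep j
    have htop : Submodule.span ℚ (Q j) ⊔ ⨆ k, ⨆ (_ : k ≠ j), Submodule.span ℚ (Q k) = ⊤ := by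
      rw [eq_top_iff, ← hint.submodule_iSup_eq_top]
      apply iSup_le
      intro k
      by_cases hkj : k = j
      · rw [hkj]; exact le_sup_left
      · exact le_sup_of_le_right (le_iSup₂_of_le k hkj le_rfl)
    have hc : IsCompl (Submodule.span ℚ (Q j)) (⨆ k, ⨆ (_ : k ≠ j), Submodule.span ℚ (Q k)) :=
      ⟨hcompl, codisjoint_iff.2 htop⟩
    set F : Module.Dual ℚ V := (f.comp (Submodule.span ℚ (Q j)).subtype).comp
      (Submodule.projectionOnto _ _ hc) with hF
    have hFj : ∀ i', F (p j i') = if i' = i then 1 else -(1 / (d : ℚ)) := by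
      intro i'
      have := Submodule.projectionOnto_apply_left hc ⟨p j i', hmem j i'⟩
      rw [hF, LinearMap.comp_apply, this, LinearMap.comp_apply, Submodule.subtype_apply, hf]
    have hFk : ∀ k i', k ≠ j → F (p k i') = 0 := by
      intro k i' hk
      have h1 : p k i' ∈ ⨆ k, ⨆ (_ : k ≠ j), Submodule.span ℚ (Q k) :=
        Submodule.mem_iSup_of_mem k (Submodule.mem_iSup_of_mem hk (hmem k i'))
      have := Submodule.projectionOnto_apply_right hc ⟨p k i', h1⟩
      rw [hF, LinearMap.comp_apply, this, map_zero]
    refine ⟨F, ?_⟩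
    rintro ⟨k, i'⟩ hne
    have h1 : F (q (j, i)) = 1 := by rw [hq]; simp [hFj]
    rw [h1]
    by_cases hkj : k = j
    · subst hkj
      have hi : i' ≠ i := fun hi => hne (by rw [hi])
      have h2 : F (q (k, i')) = -(1 / (d : ℚ)) := by
        rw [hq]
        simp only [hFj, if_neg hi]
      rw [h2]
      have : 0 < 1 / (d : ℚ) := by positivity
      linarith
    · have h2 : F (q (k, i')) = 0 := hFk k i' hkj
      rw [h2]
      exact one_pos
  have hinj : Function.Injective q := by
    intro x y hxy
    by_contra hne
    obtain ⟨F, hF⟩ := hsep x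
    have := hF y (Ne.symm hne)
    rw [hxy] at this
    exact lt_irrefl _ this
  have hsub : Set.range q ⊆ vertices P := by
    rintro _ ⟨x, rfl⟩
    obtain ⟨F, hF⟩ := hsep x
    rw [hPq]
    apply mem_extremePoints_convexHull_of_lt (Set.mem_range_self x) F
    rintro _ ⟨y, rfl⟩ hyx
    exact hF y fun hh => hyx (by rw [hh])
  calc r * (d + 1) = (Set.range q).ncard := by
        rw [← Set.image_univ, Set.ncard_image_of_injective _ hinj, Set.ncard_univ]
        simp
    _ ≤ _ := Set.ncard_le_ncard hsub hfin

end Splitting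

section Hexagons

variable {V : Type*} [AddCommGroup V] [Module ℚ V]
variable {A : Finset V} {B : Finset (Module.Dual ℚ V)}

/-! ### Polytopes with the maximal number of vertices -/

/-- The bipolar theorem for simplicial pairs: the facet that belongs to a dual vertex minimizing
`u x` has `x` in its cone. -/
theorem IsSimplicialPair.mem_convexHull (h : IsSimplicialPair A B)
    (h0 : (0 : V) ∈ convexHull ℚ (A : Set V)) {x : V} (hx : ∀ u ∈ B, -1 ≤ u x) :
    x ∈ convexHull ℚ (A : Set V) := by
  classical
  obtain ⟨u, hu, hmin⟩ := Finset.exists_min_image B (fun u => u x) h.nonempty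
  have hcoord : ∀ e, 0 ≤ (h.basis hu).coord e x := by
    intro e
    obtain ⟨γ, hγ, hB, -⟩ := h.exists_neighbour hu e
    have h1 := hmin _ hB
    rw [LinearMap.add_apply, LinearMap.smul_apply, smul_eq_mul] at h1
    exact nonneg_of_mul_nonneg_right (by linarith) hγ
  have hsum := h.sum_coord hu x
  have hux := hx u hu
  -- `x` is a combination of the vertices of the facet and the origin
  have h1 : ∑ o : Option (tight A u), (o.elim (1 + u x) fun e => (h.basis hu).coord e x) •
      (o.elim 0 fun e => (e : V)) ∈ convexHull ℚ (A : Set V) := by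
    apply (convex_convexHull ℚ _).sum_mem
    · rintro (_ | e) _
      · simp only [Option.elim]
        linarith
      · exact hcoord e
    · rw [Fintype.sum_option]
      simp only [Option.elim]
      rw [hsum]
      ring
    · rintro (_ | e) _
      · exact h0
      · exact subset_convexHull ℚ _ (mem_tight.1 e.2).1
  rw [Fintype.sum_option] at h1
  simp only [Option.elim] at h1
  rwa [h.sum_coord_smul, smul_zero, zero_add] at h1

theorem neg_mem_extremePoints {P : Set V} (hP : ∀ x ∈ P, -x ∈ P) {v : V}
    (hv : v ∈ P.extremePoints ℚ) : -v ∈ P.extremePoints ℚ := by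
  rw [mem_extremePoints_iff_left] at hv ⊢
  refine ⟨hP _ hv.1, ?_⟩
  rintro x hx y hy ⟨a, b, ha, hb, hab, hxy⟩
  have := hv.2 (-x) (hP x hx) (-y) (hP y hy) ⟨a, b, ha, hb, hab, by
    rw [smul_neg, smul_neg, ← neg_add, hxy, neg_neg]⟩
  rw [← this, neg_neg]

/-- If all dual vertices take only the values `-1`, `0` and `1` on the vertices, the polytope is
centrally symmetric. -/
theorem IsSimplicialPair.neg_mem (h : IsSimplicialPair A B) {P : Set V}
    (hPA : P = convexHull ℚ (A : Set V)) (hA : (A : Set V) = vertices P) (h0 : (0 : V) ∈ P)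
    (hval : ∀ u ∈ B, ∀ v ∈ A, u v = -1 ∨ u v = 0 ∨ u v = 1) {v : V} (hv : v ∈ A) : -v ∈ A := by
  have hsymm : ∀ x ∈ P, -x ∈ P := by
    have h1 : P ⊆ (-LinearMap.id : V →ₗ[ℚ] V) ⁻¹' P := by
      conv_lhs => rw [hPA]
      refine convexHull_min ?_ (Convex.linear_preimage ?_ _)
      · intro w hw
        change -w ∈ P
        rw [hPA] at h0 ⊢
        apply h.mem_convexHull h0
        intro u hu
        rw [map_neg]
        rcases hval u hu w hw with h | h | h <;> rw [h] <;> norm_num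
      · rw [hPA]
        exact convex_convexHull ℚ _
    exact fun x hx => h1 hx
  have h2 : v ∈ P.extremePoints ℚ := by
    have : v ∈ (A : Set V) := hv
    rwa [hA] at this
  have h3 : -v ∈ (A : Set V) := by
    rw [hA]
    exact neg_mem_extremePoints hsymm h2
  exact h3

/-- A polytope with `3n` vertices: for a facet with vertices `e`, there is a fixed-point-free
involution `σ` of these vertices such that all vertices are the `e`, the `-e` and the `σ e - e`.
Moreover, the coordinate functions of the facet are integral on the lattice. -/
theorem IsSimplicialPair.exists_involution (h : IsSimplicialPair A B) {L : Submodule ℤ V}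
    {P : Set V} (hPA : P = convexHull ℚ (A : Set V)) (hA : (A : Set V) = vertices P)
    (h0 : (0 : V) ∈ P) (hBL : (B : Set (Module.Dual ℚ V)) ⊆ dualLattice L)
    (hcard : A.card = 3 * Module.finrank ℚ V) {u : Module.Dual ℚ V} (hu : u ∈ B) :
    ∃ σ : tight A u → tight A u, Function.Involutive σ ∧ (∀ e, σ e ≠ e) ∧
      (∀ v, v ∈ A ↔ ∃ e : tight A u, v = e ∨ v = -(e : V) ∨ v = (σ e : V) - e) ∧
      ∀ e, (h.basis hu).coord e ∈ dualLattice L := by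
  classical
  have hval : ∀ u ∈ B, ∀ v ∈ A, u v = -1 ∨ u v = 0 ∨ u v = 1 := fun u hu =>
    (h.levels_of_card_eq_three_mul hcard hu).2
  have hneg : ∀ v ∈ A, -v ∈ A := fun v hv => h.neg_mem hPA hA h0 hval hv
  -- each vertex of level zero has a negative coordinate; by counting, this is a bijection
  choose g hg using fun z : levelZero A u => h.exists_coord_neg hu z.2
  have hgeq : ∀ (z w : levelZero A u) e, (h.basis hu).coord e z < 0 →
      (h.basis hu).coord e w < 0 → z = w := by
    intro z w e hz hw
    obtain ⟨hzA, hz0⟩ := mem_levelZero.1 z.2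
    obtain ⟨hwA, hw0⟩ := mem_levelZero.1 w.2
    exact Subtype.ext (h.eq_of_coord_neg hu e hzA hwA hz0 hw0 hz hw)
  have hginj : Function.Injective g := by
    intro z w hzw
    exact hgeq z w (g z) (hg z) (hzw ▸ hg w)
  have hgbij : Function.Bijective g := by
    rw [Fintype.bijective_iff_injective_and_card]
    refine ⟨hginj, ?_⟩
    rw [Fintype.card_coe, Fintype.card_coe, h.card_tight hu,
      (h.levels_of_card_eq_three_mul hcard hu).1]
  have hgneg : ∀ (z : levelZero A u) e, (h.basis hu).coord e z < 0 → e = g z := by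
    intro z e he
    obtain ⟨w, rfl⟩ := hgbij.2 e
    rw [hgeq z w (g w) he (hg w)]
  set ν : levelZero A u → levelZero A u := fun z =>
    ⟨-z, by
      obtain ⟨hzA, hz0⟩ := mem_levelZero.1 z.2
      exact mem_levelZero.2 ⟨hneg _ hzA, by rw [map_neg, hz0, neg_zero]⟩⟩ with hν
  have hνcoe : ∀ z, (ν z : V) = -(z : V) := fun z => rfl
  have hcoord0 : ∀ z e, e ≠ g z → e ≠ g (ν z) → (h.basis hu).coord e z = 0 := by
    intro z e h1 h2
    apply le_antisymm
    · by_contra hcon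
      push Not at hcon
      refine h2 (hgneg (ν z) e ?_)
      rw [hνcoe, map_neg]
      linarith
    · by_contra hcon
      push Not at hcon
      exact h1 (hgneg z e hcon)
  have hgν : ∀ z, g (ν z) ≠ g z := by
    intro z hz
    have h1 := hg (ν z)
    rw [hz, hνcoe, map_neg] at h1
    linarith [hg z]
  have hform : ∀ z : levelZero A u,
      (z : V) = -(h.basis hu).coord (g z) z • ((g (ν z) : V) - g z) := by
    intro z
    have h2 := Fintype.sum_eq_add (f := fun e => (h.basis hu).coord e z) (g z) (g (ν z))
      (hgν z).symm fun e he => hcoord0 z e he.1 he.2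
    rw [h.sum_coord hu, (mem_levelZero.1 z.2).2] at h2
    have h3 : (h.basis hu).coord (g (ν z)) z = -(h.basis hu).coord (g z) z := by linarith
    have h4 := Fintype.sum_eq_add (f := fun e => (h.basis hu).coord e z • (e : V)) (g z) (g (ν z))
      (hgν z).symm fun e he => by rw [hcoord0 z e he.1 he.2, zero_smul]
    rw [h.sum_coord_smul hu, h3] at h4
    rw [neg_smul, smul_sub]
    rw [neg_smul] at h4
    rw [neg_sub, sub_eq_add_neg]
    exact h4
  -- compare with the neighbouring facet: its dual vertex is `u + coord`, and the coefficient is `1`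
  have hstep : ∀ z, u + (h.basis hu).coord (g z) ∈ B ∧ (h.basis hu).coord (g z) z = -1 := by
    intro z
    obtain ⟨γ, hγ, hB, -⟩ := h.exists_neighbour hu (g z)
    have happ : ∀ x, (u + γ • (h.basis hu).coord (g z)) x =
      u x + γ * (h.basis hu).coord (g z) x := fun x => by simp
    have hgA := (mem_tight.1 (g z).2).1
    have hzA := (mem_levelZero.1 z.2).1
    have hz0 := (mem_levelZero.1 z.2).2
    have h1 := hval _ hB (g z) hgA
    rw [happ, h.coord_self hu, (mem_tight.1 (g z).2).2] at h1
    have h2 := hval _ hB z hzA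
    rw [happ, hz0] at h2
    have h3 : γ * (h.basis hu).coord (g z) z < 0 := mul_neg_of_pos_of_neg hγ (hg z)
    have h4 : γ * (h.basis hu).coord (g z) z = -1 := by
      rcases h2 with h | h | h <;> linarith
    have h5 : γ = 1 ∨ γ = 2 := by
      rcases h1 with h | h | h
      · exfalso; linarith
      · left; linarith
      · right; linarith
    rcases h5 with rfl | rfl
    · rw [one_smul] at hB
      exact ⟨hB, by linarith⟩
    · -- otherwise `z` would be the midpoint of the points `g (ν z)` and `-g z` of `P`
      exfalso
      have h6 : (h.basis hu).coord (g z) z = -(1 / 2) := by linarith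
      have h7 := hform z
      rw [h6, neg_neg] at h7
      have hsub : ∀ v ∈ A, v ∈ P := fun v hv => by
        rw [hPA]
        exact subset_convexHull ℚ _ hv
      have hext : (z : V) ∈ P.extremePoints ℚ := by
        have : (z : V) ∈ (A : Set V) := hzA
        rwa [hA] at this
      have hgν' := mem_tight.1 (g (ν z)).2
      have h8 := (mem_extremePoints_iff_left.1 hext).2 _ (hsub _ hgν'.1)
        _ (hsub _ (hneg _ hgA)) ⟨1 / 2, 1 / 2, by norm_num, by norm_num, by norm_num, by
          conv_rhs => rw [h7]
          module⟩
      have h9 := hgν'.2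
      rw [h8, hz0] at h9
      norm_num at h9
  have hz : ∀ z : levelZero A u, (z : V) = (g (ν z) : V) - g z := by
    intro z
    have := hform z
    rwa [(hstep z).2, neg_neg, one_smul] at this
  set G := Equiv.ofBijective g hgbij with hG
  have hgG : ∀ e, g (G.symm e) = e := fun e => G.apply_symm_apply e
  have hGg : ∀ z, G.symm (g z) = z := fun z => G.symm_apply_apply z
  have hνν : ∀ z, ν (ν z) = z := fun z => Subtype.ext (by rw [hνcoe, hνcoe, neg_neg])
  refine ⟨fun e => g (ν (G.symm e)), ?_, ?_, ?_, ?_⟩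
  · intro e
    change g (ν (G.symm (g (ν (G.symm e))))) = e
    rw [hGg, hνν, hgG]
  · intro e he
    apply hgν (G.symm e)
    rw [hgG]
    exact he
  · intro v
    constructor
    · intro hv
      rcases hval u hu v hv with h1 | h1 | h1
      · exact ⟨⟨v, mem_tight.2 ⟨hv, h1⟩⟩, Or.inl rfl⟩
      · have hv' := mem_levelZero.2 ⟨hv, h1⟩
        refine ⟨g ⟨v, hv'⟩, Or.inr (Or.inr ?_)⟩
        have := hz ⟨v, hv'⟩
        simpa only [hGg] using this
      · have h2 : -v ∈ tight A u := mem_tight.2 ⟨hneg v hv, by rw [map_neg, h1]⟩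
        exact ⟨⟨-v, h2⟩, Or.inr (Or.inl (by simp))⟩
    · rintro ⟨e, rfl | rfl | rfl⟩
      · exact (mem_tight.1 e.2).1
      · exact hneg _ (mem_tight.1 e.2).1
      · have := hz (G.symm e)
        rw [hgG] at this
        change (g (ν (G.symm e)) : V) - e ∈ A
        rw [← this]
        exact (mem_levelZero.1 (G.symm e).2).1
  · intro e
    have h1 := hBL (hstep (G.symm e)).1
    rw [hgG] at h1
    have h2 := (dualLattice L).sub_mem h1 (hBL hu)
    rwa [add_sub_cancel_left] at h2

/-- The points of a fixed-point-free involution of a finite set come in pairs. -/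
theorem exists_equiv_prod_of_involutive {ι : Type*} [Finite ι] {σ : ι → ι}
    (hσ : Function.Involutive σ) (hne : ∀ e, σ e ≠ e) :
    ∃ (m : ℕ) (φ : Fin m × Fin 2 ≃ ι), ∀ i, σ (φ (i, 0)) = φ (i, 1) := by
  classical
  obtain ⟨k, ⟨ε⟩⟩ := Finite.exists_equiv_fin ι
  obtain ⟨m, ⟨α⟩⟩ := Finite.exists_equiv_fin {e : ι // ε e < ε (σ e)}
  set f : Fin m × Fin 2 → ι := fun x => if x.2 = 0 then (α.symm x.1 : ι) else σ (α.symm x.1)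
    with hf
  have h0 : ∀ i, f (i, 0) = α.symm i := fun i => by simp [hf]
  have h1 : ∀ i, f (i, 1) = σ (α.symm i) := fun i => by simp [hf]
  have hmixed : ∀ a b : {e : ι // ε e < ε (σ e)}, (a : ι) ≠ σ b := by
    intro a b hab
    have ha := a.2
    rw [hab, hσ] at ha
    exact lt_asymm ha b.2
  have hbij : Function.Bijective f := by
    constructor
    · rintro ⟨i, s⟩ ⟨j, t⟩ hxy
      fin_cases s <;> fin_cases t
      · change f (i, 0) = f (j, 0) at hxy
        rw [h0, h0] at hxy
        rw [α.symm.injective (Subtype.ext hxy)]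
      · change f (i, 0) = f (j, 1) at hxy
        rw [h0, h1] at hxy
        exact absurd hxy (hmixed _ _)
      · change f (i, 1) = f (j, 0) at hxy
        rw [h0, h1] at hxy
        exact absurd hxy.symm (hmixed _ _)
      · change f (i, 1) = f (j, 1) at hxy
        rw [h1, h1] at hxy
        rw [α.symm.injective (Subtype.ext (hσ.injective hxy))]
    · intro e
      rcases lt_trichotomy (ε e) (ε (σ e)) with h | h | h
      · exact ⟨(α ⟨e, h⟩, 0), by rw [h0]; simp⟩
      · exact absurd (ε.injective h).symm (hne e)
      · have h' : ε (σ e) < ε (σ (σ e)) := by rwa [hσ]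
        exact ⟨(α ⟨σ e, h'⟩, 1), by rw [h1]; simp [hσ e]⟩
  refine ⟨m, Equiv.ofBijective f hbij, fun i => ?_⟩
  change σ (f (i, 0)) = f (i, 1)
  rw [h0, h1]

/-- The vertices of the reflexive hexagon, in cyclic order: the ray generators of the fan of
`S₃`. -/
def hexagon : Fin 6 → Fin 2 → ℚ :=
  ![![1, 0], ![1, 1], ![0, 1], ![-1, 0], ![-1, -1], ![0, -1]]

/-- A polytope with `3n` vertices is the free sum of hexagons, in a suitable lattice basis. -/
theorem IsSimplicialPair.exists_hexagon_basis (h : IsSimplicialPair A B) {L : Submodule ℤ V}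
    {P : Set V} (hPA : P = convexHull ℚ (A : Set V)) (hA : (A : Set V) = vertices P)
    (h0 : (0 : V) ∈ P) (hAL : (A : Set V) ⊆ L) (hBL : (B : Set (Module.Dual ℚ V)) ⊆ dualLattice L)
    (hcard : A.card = 3 * Module.finrank ℚ V) :
    ∃ (m : ℕ) (b : Module.Basis (Fin m × Fin 2) ℚ V),
      (∀ v, v ∈ A ↔ ∃ i k, v = hexagon k 0 • b (i, 0) + hexagon k 1 • b (i, 1)) ∧
      ∀ x, x ∈ L ↔ ∀ j, ∃ k : ℤ, b.repr x j = k := by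
  obtain ⟨u, hu⟩ := h.nonempty
  obtain ⟨σ, hσ, hne, hvert, hint⟩ := h.exists_involution hPA hA h0 hBL hcard hu
  obtain ⟨m, φ, hφ⟩ := exists_equiv_prod_of_involutive hσ hne
  have hφ' : ∀ i, σ (φ (i, 1)) = φ (i, 0) := fun i => by rw [← hφ, hσ]
  -- reverse the sign of the second vector of each pair
  set s : Fin m × Fin 2 → ℚˣ := fun x => if x.2 = 0 then 1 else -1 with hs
  set b := ((h.basis hu).reindex φ.symm).unitsSMul s with hb
  have hb0 : ∀ i, b (i, 0) = φ (i, 0) := fun i => by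
    rw [hb, Module.Basis.unitsSMul_apply, Module.Basis.reindex_apply, Equiv.symm_symm,
      h.basis_apply]
    simp [hs]
  have hb1 : ∀ i, b (i, 1) = -(φ (i, 1) : V) := fun i => by
    rw [hb, Module.Basis.unitsSMul_apply, Module.Basis.reindex_apply, Equiv.symm_symm,
      h.basis_apply]
    simp [hs]
  refine ⟨m, b, ?_, ?_⟩
  · intro v
    rw [hvert]
    constructor
    · rintro ⟨e, he⟩
      obtain ⟨⟨i, t⟩, rfl⟩ := φ.surjective e
      refine ⟨i, ?_⟩
      rw [hb0, hb1]
      fin_cases t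
      · simp only [Fin.zero_eta, hφ] at he
        rcases he with rfl | rfl | rfl
        · exact ⟨0, by simp [hexagon]⟩
        · exact ⟨3, by simp [hexagon]⟩
        · exact ⟨4, by simp [hexagon]; abel⟩
      · simp only [Fin.mk_one, hφ'] at he
        rcases he with rfl | rfl | rfl
        · exact ⟨5, by simp [hexagon]⟩
        · exact ⟨2, by simp [hexagon]⟩
        · exact ⟨1, by simp [hexagon]; abel⟩
    · rintro ⟨i, k, rfl⟩
      rw [hb0, hb1]
      fin_cases k
      · exact ⟨φ (i, 0), Or.inl (by simp [hexagon])⟩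
      · exact ⟨φ (i, 1), Or.inr (Or.inr (by simp [hexagon, hφ']; abel))⟩
      · exact ⟨φ (i, 1), Or.inr (Or.inl (by simp [hexagon]))⟩
      · exact ⟨φ (i, 0), Or.inr (Or.inl (by simp [hexagon]))⟩
      · exact ⟨φ (i, 0), Or.inr (Or.inr (by simp [hexagon, hφ]; abel))⟩
      · exact ⟨φ (i, 1), Or.inl (by simp [hexagon])⟩
  · intro x
    constructor
    · intro hx j
      obtain ⟨k, hk⟩ := hint (φ j) x hx
      have h1 : b.repr x j = (s j)⁻¹ • (h.basis hu).coord (φ j) x := by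
        rw [hb, Module.Basis.repr_unitsSMul, Module.Basis.repr_reindex_apply]
        rfl
      rw [h1, hk, hs]
      dsimp only
      split_ifs
      · exact ⟨k, by simp⟩
      · exact ⟨-k, by simp [Units.smul_def]⟩
    · intro hx
      rw [← b.sum_repr x]
      apply Submodule.sum_mem
      intro j _
      obtain ⟨k, hk⟩ := hx j
      rw [hk, Int.cast_smul_eq_zsmul]
      apply L.smul_mem
      obtain ⟨i, t⟩ := j
      fin_cases t
      · simp only [Fin.zero_eta]
        rw [hb0]
        exact hAL (mem_tight.1 (φ (i, 0)).2).1
      · simp only [Fin.mk_one]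
        rw [hb1]
        exact L.neg_mem (hAL (mem_tight.1 (φ (i, 1)).2).1)

end Hexagons

/-! ### The fan of `S₃` -/

section HexagonFan

/-- The cone over a set of vertices of the hexagon. -/
def hexCone (K : Finset (Fin 6)) : PointedCone ℚ (Fin 2 → ℚ) :=
  PointedCone.hull ℚ (hexagon '' (K : Set (Fin 6)))

/-- A set of vertices of the hexagon that contains no two nonadjacent ones: the vertex set of a
proper face. -/
def IsHexFace (K : Finset (Fin 6)) : Prop := ∀ k ∈ K, k + 2 ∉ K ∧ k + 3 ∉ K

instance (K : Finset (Fin 6)) : Decidable (IsHexFace K) := by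
  unfold IsHexFace
  infer_instance

theorem IsHexFace.eq_empty_or : ∀ K : Finset (Fin 6), IsHexFace K →
    K = ∅ ∨ ∃ k, K = {k} ∨ K = {k, k + 1} := by
  decide

theorem mem_hull_pair {W : Type*} [AddCommGroup W] [Module ℚ W] {a b x : W} :
    x ∈ PointedCone.hull ℚ {a, b} ↔ ∃ s t : ℚ, 0 ≤ s ∧ 0 ≤ t ∧ s • a + t • b = x := by
  rw [PointedCone.hull, Submodule.mem_span_pair]
  constructor
  · rintro ⟨s, t, h⟩
    exact ⟨s, t, s.2, t.2, h⟩
  · rintro ⟨s, t, hs, ht, h⟩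
    exact ⟨⟨s, hs⟩, ⟨t, ht⟩, h⟩

theorem mem_hull_singleton {W : Type*} [AddCommGroup W] [Module ℚ W] {a x : W} :
    x ∈ PointedCone.hull ℚ {a} ↔ ∃ s : ℚ, 0 ≤ s ∧ s • a = x := by
  rw [PointedCone.hull, Submodule.mem_span_singleton]
  constructor
  · rintro ⟨s, h⟩
    exact ⟨s, s.2, h⟩
  · rintro ⟨s, hs, h⟩
    exact ⟨⟨s, hs⟩, h⟩

theorem planeRay_eq_hexagon (i : Fin 3) : planeRay i = hexagon (![0, 2, 4] i) := by
  fin_cases i <;> rfl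

/-- The ray opposite to `planeRay i`, which a blow-up inserts, lies in no two-dimensional cone of
`planeFan` that contains `planeRay i`. This tells the cones that a blow-up inserts from those that
later ones remove. -/
theorem neg_planeRay_notMem_hull_pair (i j : Fin 3) (hij : i ≠ j) :
    -planeRay i ∉ PointedCone.hull ℚ {planeRay i, planeRay j} := by
  rw [mem_hull_pair]
  rintro ⟨s, t, hs, ht, h⟩
  have h0 := congrFun h 0
  have h1 := congrFun h 1
  fin_cases i <;> fin_cases j <;> simp [planeRay] at h0 h1 hij <;> linarith

theorem planeRay_notMem_hull_singleton (i j : Fin 3) (hij : i ≠ j) :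
    planeRay i ∉ PointedCone.hull ℚ {planeRay j} := by
  rw [mem_hull_singleton]
  rintro ⟨s, hs, h⟩
  have h0 := congrFun h 0
  have h1 := congrFun h 1
  fin_cases i <;> fin_cases j <;> simp [planeRay] at h0 h1 hij <;> linarith

theorem planeRay_ne_zero (i : Fin 3) : planeRay i ≠ 0 := by
  intro h
  have h0 := congrFun h 0
  have h1 := congrFun h 1
  fin_cases i <;> simp [planeRay] at h0 h1

theorem ne_hull_pair_of_neg_mem {τ : PointedCone ℚ (Fin 2 → ℚ)} {i j : Fin 3} (hij : i ≠ j)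
    (h : -planeRay i ∈ τ) : τ ≠ PointedCone.hull ℚ {planeRay i, planeRay j} := by
  rintro rfl
  exact neg_planeRay_notMem_hull_pair i j hij h

theorem ne_hull_pair_of_neg_mem' {τ : PointedCone ℚ (Fin 2 → ℚ)} {i j : Fin 3} (hij : i ≠ j)
    (h : -planeRay i ∈ τ) : τ ≠ PointedCone.hull ℚ {planeRay j, planeRay i} := by
  rw [Set.pair_comm]
  exact ne_hull_pair_of_neg_mem hij h

theorem hull_singleton_ne_hull_pair (k i j : Fin 3) (hij : i ≠ j) :
    PointedCone.hull ℚ {planeRay k} ≠ PointedCone.hull ℚ {planeRay i, planeRay j} := by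
  intro h
  have hi : planeRay i ∈ PointedCone.hull ℚ {planeRay k} :=
    h ▸ PointedCone.subset_hull (Set.mem_insert _ _)
  have hj : planeRay j ∈ PointedCone.hull ℚ {planeRay k} :=
    h ▸ PointedCone.subset_hull (Set.mem_insert_of_mem _ rfl)
  have hik : i = k := by
    by_contra hik
    exact planeRay_notMem_hull_singleton i k hik hi
  have hjk : j = k := by
    by_contra hjk
    exact planeRay_notMem_hull_singleton j k hjk hj
  exact hij (hik.trans hjk.symm)

theorem bot_ne_hull_pair (i j : Fin 3) :
    (⊥ : PointedCone ℚ (Fin 2 → ℚ)) ≠ PointedCone.hull ℚ {planeRay i, planeRay j} := by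
  intro h
  have hi : planeRay i ∈ (⊥ : PointedCone ℚ (Fin 2 → ℚ)) :=
    h ▸ PointedCone.subset_hull (Set.mem_insert _ _)
  exact planeRay_ne_zero i ((Submodule.mem_bot _).1 hi)

theorem hexCone_pair (k l : Fin 6) : hexCone {k, l} = PointedCone.hull ℚ {hexagon k, hexagon l} := by
  rw [hexCone, Finset.coe_pair, Set.image_pair]

theorem hexCone_singleton (k : Fin 6) : hexCone {k} = PointedCone.hull ℚ {hexagon k} := by
  rw [hexCone, Finset.coe_singleton, Set.image_singleton]

theorem hexCone_empty : hexCone ∅ = ⊥ := by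
  rw [hexCone, Finset.coe_empty, Set.image_empty, PointedCone.hull, Submodule.span_empty]

theorem finset_fin_three_cases : ∀ s : Finset (Fin 3), s ≠ Finset.univ →
    s = ∅ ∨ (∃ i, s = {i}) ∨ s = {0, 1} ∨ s = {1, 2} ∨ s = {2, 0} := by
  decide

theorem mem_planeFan {τ : PointedCone ℚ (Fin 2 → ℚ)} :
    τ ∈ planeFan ↔ τ = ⊥ ∨ (∃ i, τ = PointedCone.hull ℚ {planeRay i}) ∨
      τ = PointedCone.hull ℚ {planeRay 0, planeRay 1} ∨
      τ = PointedCone.hull ℚ {planeRay 1, planeRay 2} ∨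
      τ = PointedCone.hull ℚ {planeRay 2, planeRay 0} := by
  classical
  constructor
  · rintro ⟨s, hs, rfl⟩
    obtain ⟨t, rfl⟩ : ∃ t : Finset (Fin 3), (t : Set (Fin 3)) = s :=
      ⟨s.toFinite.toFinset, by simp⟩
    have ht : t ≠ Finset.univ := by
      rintro rfl
      exact hs Finset.coe_univ
    rcases finset_fin_three_cases t ht with rfl | ⟨i, rfl⟩ | rfl | rfl | rfl
    · left
      simp [PointedCone.hull]
    · right; left
      exact ⟨i, by simp⟩
    · right; right; left
      rw [Finset.coe_pair, Set.image_pair]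
    · right; right; right; left
      rw [Finset.coe_pair, Set.image_pair]
    · right; right; right; right
      rw [Finset.coe_pair, Set.image_pair]
  · have hne : ∀ t : Finset (Fin 3), t ≠ Finset.univ → (t : Set (Fin 3)) ≠ Set.univ := by
      intro t ht h
      exact ht (Finset.coe_eq_univ.1 h)
    rintro (rfl | ⟨i, rfl⟩ | rfl | rfl | rfl)
    · exact ⟨(∅ : Finset (Fin 3)), hne _ (by decide), by simp [PointedCone.hull]⟩
    · exact ⟨({i} : Finset (Fin 3)), hne _ (by revert i; decide), by simp⟩
    · exact ⟨({0, 1} : Finset (Fin 3)), hne _ (by decide), by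
        rw [Finset.coe_pair, Set.image_pair]⟩
    · exact ⟨({1, 2} : Finset (Fin 3)), hne _ (by decide), by
        rw [Finset.coe_pair, Set.image_pair]⟩
    · exact ⟨({2, 0} : Finset (Fin 3)), hne _ (by decide), by
        rw [Finset.coe_pair, Set.image_pair]⟩

/-- The three blow-ups turn the fan of the plane into the fan of the hexagon. -/
theorem mem_s3Fan {τ : PointedCone ℚ (Fin 2 → ℚ)} :
    τ ∈ s3Fan ↔ ∃ K, IsHexFace K ∧ τ = hexCone K := by
  have r0 : planeRay 0 = hexagon 0 := rfl
  have r1 : planeRay 1 = hexagon 2 := rfl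
  have r2 : planeRay 2 = hexagon 4 := rfl
  have s01 : planeRay 0 + planeRay 1 = hexagon 1 := by
    ext i; fin_cases i <;> simp [planeRay, hexagon]
  have s12 : planeRay 1 + planeRay 2 = hexagon 3 := by
    ext i; fin_cases i <;> simp [planeRay, hexagon]
  have s20 : planeRay 2 + planeRay 0 = hexagon 5 := by
    ext i; fin_cases i <;> simp [planeRay, hexagon]
  have n2 : -planeRay 2 = hexagon 1 := by
    ext i; fin_cases i <;> simp [planeRay, hexagon]
  have n0 : -planeRay 0 = hexagon 3 := by
    ext i; fin_cases i <;> simp [planeRay, hexagon]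
  have hmem : ∀ (k : Fin 6) (K : Finset (Fin 6)), k ∈ K → hexagon k ∈ hexCone K :=
    fun k K hk => PointedCone.subset_hull ⟨k, hk, rfl⟩
  simp only [s3Fan, blowUpFan, Set.mem_union, Set.mem_sdiff, mem_planeFan, Set.mem_insert_iff,
    Set.mem_singleton_iff, s01, s12, s20]
  constructor
  · rintro (⟨⟨⟨h, h01⟩ | h, h12⟩ | h, h20⟩ | h)
    · rcases h with rfl | ⟨i, rfl⟩ | h | h | h
      · exact ⟨∅, by decide, hexCone_empty.symm⟩
      · refine ⟨{![0, 2, 4] i}, by clear h01 h12 h20; revert i; decide, ?_⟩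
        rw [hexCone_singleton, planeRay_eq_hexagon]
      · exact absurd h h01
      · exact absurd h h12
      · exact absurd h h20
    · rcases h with rfl | rfl | rfl
      · exact ⟨{0, 1}, by decide, by rw [hexCone_pair, r0]⟩
      · exact ⟨{1}, by decide, by rw [hexCone_singleton]⟩
      · exact ⟨{1, 2}, by decide, by rw [hexCone_pair, r1]⟩
    · rcases h with rfl | rfl | rfl
      · exact ⟨{2, 3}, by decide, by rw [hexCone_pair, r1]⟩
      · exact ⟨{3}, by decide, by rw [hexCone_singleton]⟩
      · exact ⟨{3, 4}, by decide, by rw [hexCone_pair, r2]⟩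
    · rcases h with rfl | rfl | rfl
      · exact ⟨{4, 5}, by decide, by rw [hexCone_pair, r2]⟩
      · exact ⟨{5}, by decide, by rw [hexCone_singleton]⟩
      · exact ⟨{5, 0}, by decide, by rw [hexCone_pair, r0]⟩
  · have hne_one : ∀ K : Finset (Fin 6), 1 ∈ K →
        hexCone K ≠ PointedCone.hull ℚ {planeRay 1, planeRay 2} ∧
        hexCone K ≠ PointedCone.hull ℚ {planeRay 2, planeRay 0} := by
      intro K hK
      have h : -planeRay 2 ∈ hexCone K := n2 ▸ hmem 1 K hK
      exact ⟨ne_hull_pair_of_neg_mem' (by decide) h, ne_hull_pair_of_neg_mem (by decide) h⟩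
    have hne_three : ∀ K : Finset (Fin 6), 3 ∈ K →
        hexCone K ≠ PointedCone.hull ℚ {planeRay 2, planeRay 0} := by
      intro K hK
      exact ne_hull_pair_of_neg_mem' (by decide) (n0 ▸ hmem 3 K hK)
    have hcone_ray : ∀ i : Fin 3, hexCone {![0, 2, 4] i} = PointedCone.hull ℚ {planeRay i} := by
      intro i
      rw [hexCone_singleton, planeRay_eq_hexagon]
    have hne_ray : ∀ i a b : Fin 3, a ≠ b →
        hexCone {![0, 2, 4] i} ≠ PointedCone.hull ℚ {planeRay a, planeRay b} := by
      intro i a b hab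
      rw [hcone_ray]
      exact hull_singleton_ne_hull_pair i a b hab
    rintro ⟨K, hK, rfl⟩
    rcases IsHexFace.eq_empty_or K hK with rfl | ⟨k, rfl | rfl⟩
    · rw [hexCone_empty]
      exact Or.inl ⟨Or.inl ⟨Or.inl ⟨Or.inl rfl, bot_ne_hull_pair _ _⟩, bot_ne_hull_pair _ _⟩,
        bot_ne_hull_pair _ _⟩
    · fin_cases k
      · exact Or.inl ⟨Or.inl ⟨Or.inl ⟨Or.inr (Or.inl ⟨0, hcone_ray 0⟩), hne_ray 0 _ _ (by decide)⟩,
          hne_ray 0 _ _ (by decide)⟩, hne_ray 0 _ _ (by decide)⟩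
      · have h := hne_one {1} (by decide)
        exact Or.inl ⟨Or.inl ⟨Or.inr (Or.inr (Or.inl (hexCone_singleton 1))), h.1⟩, h.2⟩
      · exact Or.inl ⟨Or.inl ⟨Or.inl ⟨Or.inr (Or.inl ⟨1, hcone_ray 1⟩), hne_ray 1 _ _ (by decide)⟩,
          hne_ray 1 _ _ (by decide)⟩, hne_ray 1 _ _ (by decide)⟩
      · have h := hne_three {3} (by decide)
        exact Or.inl ⟨Or.inr (Or.inr (Or.inl (hexCone_singleton 3))), h⟩
      · exact Or.inl ⟨Or.inl ⟨Or.inl ⟨Or.inr (Or.inl ⟨2, hcone_ray 2⟩), hne_ray 2 _ _ (by decide)⟩,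
          hne_ray 2 _ _ (by decide)⟩, hne_ray 2 _ _ (by decide)⟩
      · exact Or.inr (Or.inr (Or.inl (hexCone_singleton 5)))
    · fin_cases k
      · have h := hne_one {0, 1} (by decide)
        exact Or.inl ⟨Or.inl ⟨Or.inr (Or.inl (hexCone_pair 0 1)), h.1⟩, h.2⟩
      · have h := hne_one {1, 2} (by decide)
        exact Or.inl ⟨Or.inl ⟨Or.inr (Or.inr (Or.inr (hexCone_pair 1 2))), h.1⟩, h.2⟩
      · have h := hne_three {2, 3} (by decide)
        exact Or.inl ⟨Or.inr (Or.inl (hexCone_pair 2 3)), h⟩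
      · have h := hne_three {3, 4} (by decide)
        exact Or.inl ⟨Or.inr (Or.inr (Or.inr (hexCone_pair 3 4))), h⟩
      · exact Or.inr (Or.inl (hexCone_pair 4 5))
      · exact Or.inr (Or.inr (Or.inr (hexCone_pair 5 0)))

end HexagonFan

section ProductFan

/-! ### The fan of a free sum of hexagons -/

theorem isHexFace_of_functional (g : Module.Dual ℚ (Fin 2 → ℚ)) (hg : ∀ k, -1 ≤ g (hexagon k)) :
    IsHexFace (Finset.univ.filter fun k => g (hexagon k) = -1) := by
  have h2 : ∀ k, hexagon k + hexagon (k + 2) = hexagon (k + 1) := by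
    intro k
    ext i
    fin_cases k <;> fin_cases i <;> simp [hexagon]
  have h3 : ∀ k, hexagon (k + 3) = -hexagon k := by
    intro k
    ext i
    fin_cases k <;> fin_cases i <;> simp [hexagon]
  intro k hk
  rw [Finset.mem_filter] at hk
  constructor
  · intro h
    have h4 := hg (k + 1)
    rw [← h2, map_add, hk.2, (Finset.mem_filter.1 h).2] at h4
    norm_num at h4
  · intro h
    have h4 := (Finset.mem_filter.1 h).2
    rw [h3, map_neg, hk.2] at h4
    norm_num at h4

theorem exists_functional_of_isHexFace {K : Finset (Fin 6)} (hK : IsHexFace K) :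
    ∃ g : Module.Dual ℚ (Fin 2 → ℚ), ∀ k, -1 ≤ g (hexagon k) ∧ (g (hexagon k) = -1 ↔ k ∈ K) := by
  suffices h : ∃ p q : ℚ, ∀ k, -1 ≤ p * hexagon k 0 + q * hexagon k 1 ∧
      (p * hexagon k 0 + q * hexagon k 1 = -1 ↔ k ∈ K) by
    obtain ⟨p, q, h⟩ := h
    refine ⟨p • LinearMap.proj 0 + q • LinearMap.proj 1, ?_⟩
    simpa using h
  rcases IsHexFace.eq_empty_or K hK with rfl | ⟨k, rfl | rfl⟩
  · exact ⟨0, 0, by simp⟩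
  · fin_cases k
    · refine ⟨-1, 1 / 2, fun l => ?_⟩
      fin_cases l <;> simp [hexagon] <;> norm_num
    · refine ⟨-1 / 2, -1 / 2, fun l => ?_⟩
      fin_cases l <;> simp [hexagon] <;> norm_num
    · refine ⟨1 / 2, -1, fun l => ?_⟩
      fin_cases l <;> simp [hexagon] <;> norm_num
    · refine ⟨1, -1 / 2, fun l => ?_⟩
      fin_cases l <;> simp [hexagon] <;> norm_num
    · refine ⟨1 / 2, 1 / 2, fun l => ?_⟩
      fin_cases l <;> simp [hexagon] <;> norm_num
    · refine ⟨-1 / 2, 1, fun l => ?_⟩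
      fin_cases l <;> simp [hexagon] <;> norm_num
  · fin_cases k
    · refine ⟨-1, 0, fun l => ?_⟩
      fin_cases l <;> simp [hexagon] <;> norm_num
    · refine ⟨0, -1, fun l => ?_⟩
      fin_cases l <;> simp [hexagon] <;> norm_num
    · refine ⟨1, -1, fun l => ?_⟩
      fin_cases l <;> simp [hexagon] <;> norm_num
    · refine ⟨1, 0, fun l => ?_⟩
      fin_cases l <;> simp [hexagon] <;> norm_num
    · refine ⟨0, 1, fun l => ?_⟩
      fin_cases l <;> simp [hexagon] <;> norm_num
    · refine ⟨-1, 1, fun l => ?_⟩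
      fin_cases l <;> simp [hexagon] <;> norm_num

/-- The cones of the fan of `S₃` are the cones over the proper faces of the hexagon. -/
theorem mem_s3Fan_iff_functional {τ : PointedCone ℚ (Fin 2 → ℚ)} :
    τ ∈ s3Fan ↔ ∃ g : Module.Dual ℚ (Fin 2 → ℚ), (∀ k, -1 ≤ g (hexagon k)) ∧
      τ = PointedCone.hull ℚ (hexagon '' {k | g (hexagon k) = -1}) := by
  rw [mem_s3Fan]
  constructor
  · rintro ⟨K, hK, rfl⟩
    obtain ⟨g, hg⟩ := exists_functional_of_isHexFace hK
    refine ⟨g, fun k => (hg k).1, ?_⟩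
    rw [hexCone]
    congr 2
    ext k
    exact (hg k).2.symm
  · rintro ⟨g, hg, rfl⟩
    refine ⟨_, isHexFace_of_functional g hg, ?_⟩
    rw [hexCone, Finset.coe_filter]
    simp

theorem hull_iUnion_single {m : ℕ} (s : Fin m → Set (Fin 2 → ℚ)) :
    PointedCone.hull ℚ (⋃ i, (fun x => (Pi.single i x : Fin m → Fin 2 → ℚ)) '' s i) =
      Submodule.pi Set.univ fun i => PointedCone.hull ℚ (s i) := by
  rw [← Submodule.iSup_map_single, PointedCone.hull, Submodule.span_iUnion]
  congr 1
  ext1 i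
  rw [PointedCone.hull, Submodule.map_span]
  rfl

variable {V : Type*} [AddCommGroup V] [Module ℚ V]

/-- The fan of a polytope in terms of its dual: every cone is generated by the vertices at which
some point of the dual polytope takes the value `-1`. -/
theorem mem_faceFan {P : Set V} {A : Finset V} (hPA : P = convexHull ℚ (A : Set V))
    (h0 : ZeroInInterior P) {σ : PointedCone ℚ V} :
    σ ∈ faceFan P ↔ ∃ f : Module.Dual ℚ V, (∀ v ∈ A, -1 ≤ f v) ∧
      σ = PointedCone.hull ℚ (tight A f : Set V) := by
  have hzero := zero_mem_of_zeroInInterior h0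
  have hhull : ∀ f : Module.Dual ℚ V, (∀ v ∈ A, -1 ≤ f v) →
      PointedCone.hull ℚ {x ∈ P | f x = -1} = PointedCone.hull ℚ (tight A f : Set V) := by
    intro f hf
    apply le_antisymm
    · rw [PointedCone.hull, Submodule.span_le]
      rintro x ⟨hx, hfx⟩
      rw [hPA] at hx
      obtain ⟨w, hw0, hw1, rfl⟩ := Finset.mem_convexHull'.1 hx
      -- weights away from the face vanish
      have h1 : ∑ v ∈ A, w v * (f v + 1) = 0 := by
        simp only [mul_add, mul_one]
        rw [Finset.sum_add_distrib, hw1]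
        rw [map_sum] at hfx
        simp only [map_smul, smul_eq_mul] at hfx
        rw [hfx]
        norm_num
      rw [Finset.sum_eq_zero_iff_of_nonneg
        fun v hv => mul_nonneg (hw0 v hv) (by linarith [hf v hv])] at h1
      apply Submodule.sum_mem
      intro v hv
      rcases mul_eq_zero.1 (h1 v hv) with h | h
      · rw [h, zero_smul]
        exact Submodule.zero_mem _
      · apply PointedCone.smul_mem _ (hw0 v hv)
        exact PointedCone.subset_hull (mem_tight.2 ⟨hv, by linarith⟩)
    · apply Submodule.span_mono
      intro v hv
      obtain ⟨h1, h2⟩ := mem_tight.1 hv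
      exact ⟨by rw [hPA]; exact subset_convexHull ℚ _ h1, h2⟩
  constructor
  · rintro ⟨F, ⟨f, c, hf, rfl⟩, hne, rfl⟩
    have hc : c < 0 := by
      have h1 := hf 0 hzero
      rw [map_zero] at h1
      refine lt_of_le_of_ne h1 ?_
      rintro rfl
      apply hne
      have hf0 : ∀ x, 0 ≤ f x := by
        intro x
        obtain ⟨ε, hε, hx⟩ := h0 x
        have h2 := hf _ (hx ε hε.le le_rfl)
        rw [map_smul, smul_eq_mul] at h2
        exact nonneg_of_mul_nonneg_right h2 hε
      ext x
      refine ⟨fun hx => hx.1, fun hx => ⟨hx, ?_⟩⟩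
      have h2 := hf0 (-x)
      rw [map_neg] at h2
      linarith [hf0 x]
    have hscale : ∀ x, ((-c)⁻¹ • f) x = (-c)⁻¹ * f x := fun x => rfl
    have hc' : 0 < (-c)⁻¹ := inv_pos.2 (by linarith)
    have hcc : (-c)⁻¹ * c = -1 := by
      rw [inv_neg, neg_mul, inv_mul_cancel₀ hc.ne]
    have hf' : ∀ v ∈ A, -1 ≤ ((-c)⁻¹ • f) v := by
      intro v hv
      have := hf v (by rw [hPA]; exact subset_convexHull ℚ _ hv)
      rw [hscale, ← hcc]
      exact mul_le_mul_of_nonneg_left this hc'.le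
    refine ⟨(-c)⁻¹ • f, hf', ?_⟩
    rw [← hhull _ hf']
    congr 1
    ext x
    simp only [Set.mem_ofPred_eq, hscale, ← hcc]
    rw [mul_right_inj' hc'.ne']
  · rintro ⟨f, hf, rfl⟩
    refine ⟨{x ∈ P | f x = -1}, ⟨f, -1, ?_, rfl⟩, ?_, (hhull f hf).symm⟩
    · rw [hPA]
      exact convexHull_min hf (convex_halfSpace_ge f.isLinear _)
    · intro h
      rw [← h] at hzero
      have := hzero.2
      rw [map_zero] at this
      norm_num at this

theorem map_hull {W : Type*} [AddCommGroup W] [Module ℚ W] (φ : V →ₗ[ℚ] W) (s : Set V) :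
    PointedCone.map φ (PointedCone.hull ℚ s) = PointedCone.hull ℚ (φ '' s) := by
  rw [PointedCone.map, PointedCone.hull, Submodule.map_span]
  rfl

/-- The cone over a face of a free sum of hexagons is the product of the cones over faces of the
hexagons. -/
theorem map_hull_tight {A : Finset V} {m : ℕ} (φ : V ≃ₗ[ℚ] (Fin m → Fin 2 → ℚ))
    (hφ : ∀ v, v ∈ A ↔ ∃ i k, φ v = Pi.single i (hexagon k)) (f : Module.Dual ℚ V)
    (g : Fin m → Module.Dual ℚ (Fin 2 → ℚ))
    (hfg : ∀ i k, f (φ.symm (Pi.single i (hexagon k))) = g i (hexagon k)) :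
    PointedCone.map φ.toLinearMap (PointedCone.hull ℚ (tight A f : Set V)) =
      Submodule.pi Set.univ
        fun i => PointedCone.hull ℚ (hexagon '' {k | g i (hexagon k) = -1}) := by
  rw [map_hull, ← hull_iUnion_single]
  congr 1
  ext x
  constructor
  · rintro ⟨v, hv, rfl⟩
    obtain ⟨hvA, hfv⟩ := mem_tight.1 hv
    obtain ⟨i, k, hik⟩ := (hφ v).1 hvA
    refine Set.mem_iUnion.2 ⟨i, hexagon k, ⟨k, ?_, rfl⟩, hik.symm⟩
    change g i (hexagon k) = -1
    rw [← hfg, ← hik, φ.symm_apply_apply, hfv]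
  · intro hx
    obtain ⟨i, _, ⟨k, hk, rfl⟩, rfl⟩ := Set.mem_iUnion.1 hx
    refine ⟨φ.symm (Pi.single i (hexagon k)), mem_tight.2 ⟨?_, ?_⟩, φ.apply_symm_apply _⟩
    · exact (hφ _).2 ⟨i, k, φ.apply_symm_apply _⟩
    · rw [hfg]
      exact hk

/-- An isomorphism that carries the vertices of `P` to those of the hexagons in the coordinate planes
carries the fan of `P` to that of `(S₃)^m`. -/
theorem image_faceFan_eq_s3PowFan {P : Set V} {A : Finset V} (hPA : P = convexHull ℚ (A : Set V))
    (h0 : ZeroInInterior P) {m : ℕ} (φ : V ≃ₗ[ℚ] (Fin m → Fin 2 → ℚ))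
    (hφ : ∀ v, v ∈ A ↔ ∃ i k, φ v = Pi.single i (hexagon k)) :
    (fun σ => PointedCone.map φ.toLinearMap σ) '' faceFan P = s3PowFan m := by
  ext τ
  constructor
  · rintro ⟨σ, hσ, rfl⟩
    obtain ⟨f, hf, rfl⟩ := (mem_faceFan hPA h0).1 hσ
    set g : Fin m → Module.Dual ℚ (Fin 2 → ℚ) := fun i =>
      (f.comp φ.symm.toLinearMap).comp (LinearMap.single ℚ (fun _ => Fin 2 → ℚ) i) with hg
    have hfg : ∀ i k, f (φ.symm (Pi.single i (hexagon k))) = g i (hexagon k) := fun i k => rfl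
    refine ⟨_, fun i => ?_, map_hull_tight φ hφ f g hfg⟩
    refine mem_s3Fan_iff_functional.2 ⟨g i, fun k => ?_, rfl⟩
    rw [← hfg]
    exact hf _ ((hφ _).2 ⟨i, k, φ.apply_symm_apply _⟩)
  · rintro ⟨τ, hτ, rfl⟩
    choose g hg hgτ using fun i => mem_s3Fan_iff_functional.1 (hτ i)
    set f : Module.Dual ℚ V := (∑ i, (g i).comp (LinearMap.proj i)).comp φ.toLinearMap with hf
    have hfφ : ∀ v, f v = ∑ i, g i (φ v i) := by
      intro v
      simp [hf]
    have hfg' : ∀ v i k, φ v = Pi.single i (hexagon k) → f v = g i (hexagon k) := by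
      intro v i k hv
      rw [hfφ, hv, Finset.sum_eq_single i]
      · rw [Pi.single_eq_same]
      · intro j _ hji
        rw [Pi.single_eq_of_ne hji, map_zero]
      · simp
    have hfg : ∀ i k, f (φ.symm (Pi.single i (hexagon k))) = g i (hexagon k) := fun i k =>
      hfg' _ i k (φ.apply_symm_apply _)
    refine ⟨_, (mem_faceFan hPA h0).2 ⟨f, ?_, rfl⟩, ?_⟩
    · intro v hv
      obtain ⟨i, k, hik⟩ := (hφ v).1 hv
      rw [hfg' v i k hik]
      exact hg i k
    · change PointedCone.map φ.toLinearMap _ = _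
      rw [map_hull_tight φ hφ f g hfg]
      congr 1
      ext1 i
      exact (hgτ i).symm

theorem mem_planeLattice {x : Fin 2 → ℚ} : x ∈ planeLattice ↔ ∀ i, ∃ k : ℤ, x i = k := by
  constructor
  · intro hx
    induction hx using Submodule.span_induction with
    | mem x hx =>
      obtain ⟨j, rfl⟩ := hx
      intro i
      by_cases hij : i = j
      · subst hij
        exact ⟨1, by simp⟩
      · exact ⟨0, by simp [hij]⟩
    | zero => exact fun i => ⟨0, by simp⟩
    | add x y _ _ hx hy =>
      intro i
      obtain ⟨a, ha⟩ := hx i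
      obtain ⟨b, hb⟩ := hy i
      exact ⟨a + b, by simp [ha, hb]⟩
    | smul c x _ hx =>
      intro i
      obtain ⟨a, ha⟩ := hx i
      exact ⟨c * a, by simp [ha]⟩
  · intro h
    choose k hk using h
    have hx : x = ∑ i, k i • (Pi.single i (1 : ℚ) : Fin 2 → ℚ) := by
      ext j
      fin_cases j <;> simp [hk]
    rw [hx]
    exact Submodule.sum_mem _ fun i _ => Submodule.smul_mem _ _ (Submodule.subset_span ⟨i, rfl⟩)

/-- A polytope that is the free sum of hexagons in a lattice basis has the toric variety
`(S₃)^m`. -/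
theorem toricIso_of_hexagon_basis {L : Submodule ℤ V} {P : Set V} {A : Finset V}
    (hPA : P = convexHull ℚ (A : Set V)) (h0 : ZeroInInterior P) {m : ℕ}
    (b : Module.Basis (Fin m × Fin 2) ℚ V)
    (hA : ∀ v, v ∈ A ↔ ∃ i k, v = hexagon k 0 • b (i, 0) + hexagon k 1 • b (i, 1))
    (hL : ∀ x, x ∈ L ↔ ∀ j, ∃ k : ℤ, b.repr x j = k) :
    ToricIso L (faceFan P) (s3PowLattice m) (s3PowFan m) := by
  set φ : V ≃ₗ[ℚ] (Fin m → Fin 2 → ℚ) :=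
    b.equivFun.trans (LinearEquiv.curry ℚ ℚ (Fin m) (Fin 2)) with hφ
  have hφx : ∀ x i t, φ x i t = b.repr x (i, t) := fun x i t => rfl
  have hφhex : ∀ i k, φ (hexagon k 0 • b (i, 0) + hexagon k 1 • b (i, 1)) =
      Pi.single i (hexagon k) := by
    intro i k
    ext j t
    rw [hφx]
    by_cases hij : j = i
    · subst hij
      fin_cases t <;> simp
    · simp [hij]
  refine ⟨φ, ?_, image_faceFan_eq_s3PowFan hPA h0 φ ?_⟩
  · ext y
    rw [Submodule.mem_map]
    constructor
    · rintro ⟨x, hx, rfl⟩ i _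
      rw [SetLike.mem_coe, mem_planeLattice]
      exact fun t => (hL x).1 hx (i, t)
    · intro hy
      refine ⟨φ.symm y, (hL _).2 ?_, φ.apply_symm_apply y⟩
      rintro ⟨i, t⟩
      rw [← hφx, φ.apply_symm_apply]
      exact mem_planeLattice.1 (hy i (Set.mem_univ _)) t
  · intro v
    rw [hA]
    constructor
    · rintro ⟨i, k, rfl⟩
      exact ⟨i, k, hφhex i k⟩
    · rintro ⟨i, k, h⟩
      refine ⟨i, k, φ.injective ?_⟩
      rw [h, hφhex]

/-- Each of the `6m` rays of the fan of `(S₃)^m` has to contain a vertex of the polytope. -/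
theorem le_card_of_toricIso {L : Submodule ℤ V} {P : Set V} {A : Finset V}
    (hPA : P = convexHull ℚ (A : Set V)) (h0 : ZeroInInterior P) {m : ℕ}
    (h : ToricIso L (faceFan P) (s3PowLattice m) (s3PowFan m)) : 6 * m ≤ A.card := by
  obtain ⟨φ, -, hfan⟩ := h
  set q : Fin m × Fin 6 → Fin m → Fin 2 → ℚ := fun x => Pi.single x.1 (hexagon x.2) with hq
  -- a functional that exposes the ray generator `q x`
  have hexp : ∀ x, ∃ F : Module.Dual ℚ (Fin m → Fin 2 → ℚ), F (q x) = -1 ∧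
      ∀ y, y ≠ x → -1 < F (q y) := by
    rintro ⟨i, k⟩
    obtain ⟨g, hg⟩ := exists_functional_of_isHexFace (K := {k}) (by revert k; decide)
    refine ⟨g.comp (LinearMap.proj i), ?_, ?_⟩
    · simpa [hq] using (hg k).2.2
    · rintro ⟨j, l⟩ hne
      by_cases hij : i = j
      · subst hij
        have hlk : l ≠ k := fun h => hne (by rw [h])
        have h1 : g (hexagon l) ≠ -1 := fun h => hlk (Finset.mem_singleton.1 ((hg l).2.1 h))
        have h2 := lt_of_le_of_ne (hg l).1 h1.symm
        simpa [hq] using h2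
      · simp [hq, Pi.single_eq_of_ne hij]
  have hray : ∀ x, PointedCone.hull ℚ {q x} ∈ s3PowFan m := by
    rintro ⟨i, k⟩
    refine ⟨fun j => if j = i then hexCone {k} else hexCone ∅, fun j => ?_, ?_⟩
    · rw [mem_s3Fan]
      dsimp only
      split_ifs
      · exact ⟨{k}, by revert k; decide, rfl⟩
      · exact ⟨∅, by decide, rfl⟩
    · have h1 := hull_iUnion_single fun j : Fin m => if j = i then {hexagon k} else ∅
      have h2 : (⋃ j : Fin m, (fun x => (Pi.single j x : Fin m → Fin 2 → ℚ)) ''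
          (if j = i then {hexagon k} else ∅)) = {q (i, k)} := by
        ext x
        simp only [Set.mem_iUnion]
        constructor
        · rintro ⟨j, y, hy, rfl⟩
          split_ifs at hy with hji
          · subst hji
            rw [Set.mem_singleton_iff.1 hy]
            rfl
          · exact absurd hy (Set.notMem_empty _)
        · rintro rfl
          exact ⟨i, hexagon k, by simp, rfl⟩
      rw [← h2, h1]
      congr 1
      ext1 j
      split_ifs
      · rw [hexCone_singleton]
      · rw [hexCone, Finset.coe_empty, Set.image_empty]
  have hvert : ∀ x, ∃ v ∈ A, ∃ t : ℚ, 0 < t ∧ φ v = t • q x := by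
    intro x
    have h1 := hray x
    rw [← hfan] at h1
    obtain ⟨σ, hσ, hσx⟩ := h1
    obtain ⟨f, hf, rfl⟩ := (mem_faceFan hPA h0).1 hσ
    have hmap : PointedCone.map φ.toLinearMap (PointedCone.hull ℚ (tight A f : Set V)) =
      PointedCone.hull ℚ {q x} := hσx
    have hqx : q x ≠ 0 := by
      intro h
      obtain ⟨F, hF, -⟩ := hexp x
      rw [h, map_zero] at hF
      norm_num at hF
    have hne : (tight A f).Nonempty := by
      rw [Finset.nonempty_iff_ne_empty]
      intro he
      have h2 : q x ∈ PointedCone.hull ℚ {q x} := PointedCone.subset_hull rfl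
      rw [← hmap, he, map_hull, Finset.coe_empty, Set.image_empty, PointedCone.hull,
        Submodule.span_empty, Submodule.mem_bot] at h2
      exact hqx h2
    obtain ⟨v, hv⟩ := hne
    have h3 : φ v ∈ PointedCone.hull ℚ {q x} := by
      rw [← hmap]
      exact ⟨v, PointedCone.subset_hull hv, rfl⟩
    obtain ⟨t, ht, htv⟩ := mem_hull_singleton.1 h3
    refine ⟨v, (mem_tight.1 hv).1, t, lt_of_le_of_ne ht ?_, htv.symm⟩
    rintro rfl
    rw [zero_smul, eq_comm, map_eq_zero_iff φ φ.injective] at htv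
    have h4 := (mem_tight.1 hv).2
    rw [htv, map_zero] at h4
    norm_num at h4
  choose v hvA t ht hvt using hvert
  have hinj : Function.Injective fun x => (⟨v x, hvA x⟩ : A) := by
    intro x y hxy
    have h1 : v x = v y := congrArg Subtype.val hxy
    have h2 : t x • q x = t y • q y := by rw [← hvt, ← hvt, h1]
    by_contra hne
    obtain ⟨F, hF, hF'⟩ := hexp x
    obtain ⟨G, hG, hG'⟩ := hexp y
    have h3 := congrArg F h2
    have h4 := congrArg G h2
    simp only [map_smul, smul_eq_mul] at h3 h4
    rw [hF] at h3
    rw [hG] at h4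
    have h5 := mul_lt_mul_of_pos_left (hF' y (Ne.symm hne)) (ht y)
    have h6 := mul_lt_mul_of_pos_left (hG' x hne) (ht x)
    linarith
  have := Fintype.card_le_of_injective _ hinj
  rw [Fintype.card_coe, Fintype.card_prod, Fintype.card_fin, Fintype.card_fin] at this
  omega

end ProductFan

end FanoPolytope

theorem theorem2 {V : Type*} [AddCommGroup V] [Module ℚ V]
    (L : Submodule ℤ V) (hL : L.IsLattice ℚ)
    (n : ℕ) (hn : 0 < n) (hdim : Module.finrank ℚ V = n)
    (P : Set V) (hP : FanoPolytope.IsReflexive L P) (hs : FanoPolytope.IsSimplicial P) :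
    ((FanoPolytope.vertices P).ncard ≤ 3 * n ∧
      ((FanoPolytope.vertices P).ncard = 3 * n ↔
        Even n ∧ FanoPolytope.ToricIso L (FanoPolytope.faceFan P)
          (FanoPolytope.s3PowLattice (n / 2)) (FanoPolytope.s3PowFan (n / 2)))) ∧
    (0 < FanoPolytope.delta P →
      ((FanoPolytope.vertices P).ncard : ℚ) ≤ n + (n : ℚ) / FanoPolytope.delta P ∧
      (((FanoPolytope.vertices P).ncard : ℚ) = n + (n : ℚ) / FanoPolytope.delta P ↔
        ∃ (r : ℕ) (Q : Fin r → Set V),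
          (r : ℚ) = (n : ℚ) / FanoPolytope.delta P ∧
          P = convexHull ℚ (⋃ j, Q j) ∧
          (∀ j, FanoPolytope.IsSimplex (FanoPolytope.delta P) (Q j) ∧
            FanoPolytope.IsReflexiveInSpan L (Q j) ∧
            ∑ᶠ v ∈ FanoPolytope.vertices (Q j), v = 0) ∧
          DirectSum.IsInternal fun j => Submodule.span ℚ (Q j))) := by

  have : Module.Finite ℚ V := Module.finite_of_finrank_pos (hdim ▸ hn)
  have : Nontrivial V := Module.nontrivial_of_finrank_pos (R := ℚ) (hdim ▸ hn)
  have hfin := hP.isLatticePolytope.finite_vertices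
  set A := hfin.toFinset with hAdef
  set B := hP.isLatticePolytope_dual.finite_vertices.toFinset with hBdef
  have hA : (A : Set V) = FanoPolytope.vertices P := Set.Finite.coe_toFinset _
  have hB : (B : Set (Module.Dual ℚ V)) = FanoPolytope.vertices (FanoPolytope.dualPolytope P) :=
    Set.Finite.coe_toFinset _
  have hPA : P = convexHull ℚ (A : Set V) := by
    rw [hA, hP.isLatticePolytope.convexHull_vertices]
  have hAL : (A : Set V) ⊆ L := hA ▸ hP.isLatticePolytope.vertices_subset
  have hBL : (B : Set (Module.Dual ℚ V)) ⊆ FanoPolytope.dualLattice L :=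
    hB ▸ hP.isLatticePolytope_dual.vertices_subset
  have h := FanoPolytope.isSimplicialPair_vertices hP hs hA hB
  have hncard : (FanoPolytope.vertices P).ncard = A.card := by
    rw [← hA, Set.ncard_coe_finset]
  have h0 := FanoPolytope.zero_mem_of_zeroInInterior hP.zeroInInterior
  have hle := h.card_le_three_mul
  rw [hncard]
  rw [hdim] at hle
  refine ⟨⟨hle, ?_, ?_⟩, ?_⟩
  · intro hcard
    obtain ⟨m, b, hvert, hL'⟩ := h.exists_hexagon_basis hPA hA h0 hAL hBL (by rw [hdim, hcard])
    have hm : n = 2 * m := by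
      rw [← hdim, Module.finrank_eq_card_basis b, Fintype.card_prod, Fintype.card_fin,
        Fintype.card_fin, mul_comm]
    have hm' : n / 2 = m := by omega
    rw [hm']
    exact ⟨⟨m, by omega⟩,
      FanoPolytope.toricIso_of_hexagon_basis hPA hP.zeroInInterior b hvert hL'⟩
  · rintro ⟨⟨m, hm⟩, hiso⟩
    have := FanoPolytope.le_card_of_toricIso hPA hP.zeroInInterior hiso
    omega
  · intro hδ
    set d := FanoPolytope.delta P with hd
    have hd0 : (0 : ℚ) < d := by exact_mod_cast hδ
    -- by minimality, `δ` bounds the values away from `-1`, which are nonnegative integers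
    have hmin : ∀ u ∈ B, ∀ v ∈ A, u v ≠ -1 → (d : ℚ) ≤ u v := by
      intro u hu v hv huv
      obtain ⟨k, hk⟩ := h.integral u hu v hv
      have h1 := lt_of_le_of_ne (h.neg_one_le u hu v hv) (Ne.symm huv)
      rw [hk] at h1
      have h2 : -1 < k := by exact_mod_cast h1
      obtain ⟨l, rfl⟩ := Int.eq_ofNat_of_zero_le (show 0 ≤ k by omega)
      have h3 : d ≤ l := Nat.sInf_le
        ⟨v, hA ▸ hv, u, hB ▸ hu, fun hh => huv hh.2, by rw [hk, Int.cast_natCast]⟩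
      rw [hk, Int.cast_natCast]
      exact_mod_cast h3
    have hbound := h.mul_card_le hmin
    rw [hdim] at hbound
    refine ⟨?_, ?_, ?_⟩
    · have : (n : ℚ) + n / d = (d + 1) * n / d := by field_simp
      rw [this, le_div_iff₀ hd0]
      linarith
    · intro hcard
      have hcard' : (d : ℚ) * A.card = (d + 1) * n := by
        rw [hcard]
        field_simp
      have hval : ∀ u ∈ B, ∀ v ∈ A, u v ≠ -1 → u v = d := fun u hu v hv huv =>
        h.eq_delta_of_mul_card_eq hmin (by rw [hdim, hcard']) hu hv huv
      obtain ⟨r, Q, hr, hPQ, hQ, hint⟩ := FanoPolytope.exists_simplices hP h hPA hAL hδ hval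
        (by rw [hdim]; exact_mod_cast hcard')
      refine ⟨r, Q, ?_, hPQ, hQ, hint⟩
      rw [hdim] at hr
      rw [eq_div_iff hd0.ne', ← hr]
      push_cast
      ring
    · rintro ⟨r, Q, hr, hPQ, hQ, hint⟩
      have h1 := FanoPolytope.le_ncard_vertices_of_simplices hδ hfin hPQ
        (fun j => ⟨(hQ j).1, (hQ j).2.2⟩) hint
      rw [hncard] at h1
      have h2 : (r : ℚ) * (d + 1) ≤ A.card := by exact_mod_cast h1
      rw [← hr]
      have h3 : (r : ℚ) * d = n := by rw [hr]; field_simp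
      apply le_antisymm
      · have h4 : (d : ℚ) * A.card ≤ d * (n + r) := by rw [← h3] at hbound ⊢; linarith
        exact le_of_mul_le_mul_left h4 hd0
      · linarith
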